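/- Let $E_{jk}$ be the $4\times4$ matrix units and write $\langle\cdot\rangle$ for complex span. A grading of a Lie algebra $L$ is a decomposition $L=\bigoplus_{k}L_k$ into nonzero subspaces such that each $[L_k,L_l]$ lies in some $L_m$. It is a group grading if its index set can be chosen as a subset of a group (an Abelian one) such that $[L_k,L_l]\ne0$ implies $[L_k,L_l]\subseteq L_{k\star l}$. It is a fine group grading if it is a group grading and has no refinement other than itself that is a group grading. A real form of a complex Lie algebra $L$ is a real Lie subalgebra $P$ such that each $x\in L$ is uniquely $u+iv$ with $u,v\in P$. Consider the following decompositions of $sl(4,\mathbb C)$, with $L_1,L_2,\dots$ listed in order: - $\Gamma_3$: $\langle E_{14}\pm E_{41}\rangle$, $\langle E_{24}\pm E_{42}\rangle$, $\langle E_{34}\pm E_{43}\rangle$, $\langle E_{13}\pm E_{31}\rangle$, $\langle E_{23}\pm E_{32}\rangle$, $\langle E_{12}\pm E_{21}\rangle$ ($+$ before $-$ in each pair), $\langle E_{11}-E_{22},E_{22}-E_{33},E_{33}-E_{44}\rangle$. - $\Gamma_4$: $\langle E_{13}\mp E_{41}\rangle$, $\langle E_{14}\mp E_{31}\rangle$,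 $\langle E_{24}\mp E_{32}\rangle$, $\langle E_{23}\mp E_{42}\rangle$, $\langle E_{12}\mp E_{21}\rangle$ ($-$ before $+$), $\langle E_{34}\rangle$, $\langle E_{43}\rangle$, $\langle E_{33}-E_{44}\rangle$, $\langle E_{11}-E_{22},E_{11}+E_{22}-E_{33}-E_{44}\rangle$. - $\Gamma_5$: $\langle E_{23}\mp E_{41}\rangle$, $\langle E_{24}\mp E_{31}\rangle$, $\langle E_{13}\mp E_{42}\rangle$, $\langle E_{14}\mp E_{32}\rangle$ ($-$ before $+$), $\langle E_{12}\rangle$, $\langle E_{21}\rangle$, $\langle E_{34}\rangle$, $\langle E_{43}\rangle$, $\langle E_{11}+E_{22}-E_{33}-E_{44}\rangle$, $\langle E_{11}-E_{22}+E_{33}-E_{44},E_{11}-E_{22}-E_{33}+E_{44}\rangle$. - $\Gamma_6$: the lines spanned by $E_{11}-E_{22}+E_{33}-E_{44}$, $E_{11}-E_{22}-E_{33}+E_{44}$, $E_{11}+E_{22}-E_{33}-E_{44}$, $E_{13}-E_{24}+E_{31}-E_{42}$, $E_{13}+E_{24}-E_{31}-E_{42}$, $E_{13}+E_{24}+E_{31}+E_{42}$,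 $E_{13}-E_{24}-E_{31}+E_{42}$, $E_{21}+E_{43}$, $E_{21}-E_{43}$, $E_{14}-E_{32}$, $E_{14}+E_{32}$, $E_{23}-E_{41}$, $E_{23}+E_{41}$, $E_{12}+E_{34}$, $E_{12}-E_{34}$. - $\Gamma_7$: the lines spanned by $E_{14}+E_{23}+E_{32}+E_{41}$, $E_{14}-E_{23}-E_{32}+E_{41}$, $E_{14}-E_{23}+E_{32}-E_{41}$, $E_{14}+E_{23}-E_{32}-E_{41}$, $E_{13}+E_{24}+E_{31}+E_{42}$, $E_{13}-E_{24}-E_{31}+E_{42}$, $E_{13}-E_{24}+E_{31}-E_{42}$, $E_{13}+E_{24}-E_{31}-E_{42}$, $E_{12}+E_{21}+E_{34}+E_{43}$, $E_{12}-E_{21}-E_{34}+E_{43}$, $E_{12}-E_{21}+E_{34}-E_{43}$, $E_{12}+E_{21}-E_{34}-E_{43}$, $E_{11}-E_{22}-E_{33}+E_{44}$, $E_{11}-E_{22}+E_{33}-E_{44}$, $E_{11}+E_{22}-E_{33}-E_{44}$. - $\Gamma_8$: the lines spanned by $E_{13}+E_{24}+E_{32}+E_{41}$, $E_{13}-E_{24}-E_{32}+E_{41}$,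 $E_{13}-E_{24}+E_{32}-E_{41}$, $E_{13}+E_{24}-E_{32}-E_{41}$, $E_{14}+E_{23}+E_{31}+E_{42}$, $E_{14}-E_{23}-E_{31}+E_{42}$, $E_{14}-E_{23}+E_{31}-E_{42}$, $E_{14}+E_{23}-E_{31}-E_{42}$, $E_{11}+E_{22}-E_{33}-E_{44}$, $E_{11}-E_{22}$, $E_{33}-E_{44}$, $E_{12}-E_{21}$, $E_{34}-E_{43}$, and then the plane $\langle E_{12}+E_{21},E_{34}+E_{43}\rangle$. For symmetric invertible $K$ let $o_K(4,\mathbb C)=\{X\in\mathbb C^{4\times4}: XK=-KX^T\}$. For $F\overline F=-I$ let $su^*_F(4)=\{X\in sl(4,\mathbb C): XF=F\overline X\}$, and for hermitian $E$ with $p$ positive and $q=4-p$ negative eigenvalues let $su_E(p,q)=\{X\in sl(4,\mathbb C): XE=-EX^+\}$. With $\sigma=\left(\begin{smallmatrix}0&1\\1&0\end{smallmatrix}\right)$, $\epsilon=\left(\begin{smallmatrix}0&1\\-1&0\end{smallmatrix}\right)$ and block sums $\oplus$, put $K_1=I$, $K_2=I_2\oplus\sigma$, $K_3=\sigma\oplus\sigma$;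 $F_1=\left(\begin{smallmatrix}0&I_2\\-I_2&0\end{smallmatrix}\right)$, $F_2=\epsilon\oplus i\epsilon$; $E^{(4,0)}_1=I$; $E^{(3,1)}_1=\mathrm{diag}(1,1,1,-1)$, $E^{(3,1)}_2=I_2\oplus\sigma$; $E^{(2,2)}_1=\mathrm{diag}(1,1,-1,-1)$, $E^{(2,2)}_2=\mathrm{diag}(1,-1)\oplus\sigma$, $E^{(2,2)}_3=\sigma\oplus\sigma$, $E^{(2,2)}_5=\mathrm{diag}(1,-1)\oplus i\epsilon$. The matrices $F_1,F_2$ satisfy $F\overline F=-I$, and each $E^{(p,q)}_j$ is hermitian with $p$ positive and $q$ negative eigenvalues. In each of the following 14 cases, $\Gamma_j:sl(4,\mathbb C)=\bigoplus_k L_k$ is a fine group grading; the given algebra $P$ ($su^*_F(4)$ or $su_E(p,q)$) is a real form of $sl(4,\mathbb C)$; each $L_k$ is the complex span of $L_k\cap P$, and $\Gamma_j^{\mathcal J}:P=\bigoplus_k (L_k\cap P)$ is a fine group grading of $P$. The algebra $o_K(4,\mathbb C)\cap P$ is a real form of $o_K(4,\mathbb C)$, isomorphic to the stated real Lie algebra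 $so^*(4)=\{X\in\mathbb C^{4\times4}: X^T=-X,\ X^+F_1+F_1X=0\}$ or $so(p,q)$. Moreover $o_K(4,\mathbb C)=\bigoplus_{k\in S_j}L_k$ and $o_K(4,\mathbb C)\cap P=\bigoplus_{k\in S_j}(L_k\cap P)$, and the latter is a fine group grading of $o_K(4,\mathbb C)\cap P$ (displayed by $\Gamma_j^{\mathcal J}$). Here $S_3=\{2,4,6,8,10,12\}$, $S_4=\{1,3,5,7,9,13\}$, $S_5=\{1,3,5,7,14\}$, $S_6=\{1,2,4,5,10,12\}$, $S_7=\{3,4,6,8,10,11\}$, $S_8=\{3,4,6,8,11,12\}$. - $so^*(4)$: $\Gamma_6$ with $(K_3,\,su^*_{F_1}(4))$; $\Gamma_7$ with $(K_1,\,su^*_{F_1}(4))$; $\Gamma_8$ with $(K_2,\,su^*_{F_2}(4))$. - $so(4,0)$: $\Gamma_3$ and $\Gamma_7$ with $(K_1,\,su_{E^{(4,0)}_1}(4,0))$. - $so(3,1)$: $\Gamma_3$ with $(K_1,\,su_{E^{(3,1)}_1}(3,1))$; $\Gamma_4$ and $\Gamma_8$ with $(K_2,\,su_{E^{(3,1)}_2}(3,1))$.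 - $so(2,2)$: $\Gamma_3$ and $\Gamma_7$ with $(K_1,\,su_{E^{(2,2)}_1}(2,2))$; $\Gamma_4$ with $(K_2,\,su_{E^{(2,2)}_2}(2,2))$; $\Gamma_5$ and $\Gamma_6$ with $(K_3,\,su_{E^{(2,2)}_3}(2,2))$; $\Gamma_8$ with $(K_2,\,su_{E^{(2,2)}_5}(2,2))$. -/

import Mathlib

open Matrix

attribute [local instance 100] LieRing.ofAssociativeRing

noncomputable section

namespace FineGradings

/-! ### Gradings of Lie algebras

The Lie algebra that is graded is a Lie subalgebra `H` of an ambient Lie algebra `A`; its grading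
subspaces are given as subspaces of `A`. -/

section Gradings

variable {𝕜 A : Type} [Field 𝕜] [LieRing A] [LieAlgebra 𝕜 A]

/-- `H` is the direct sum of the nonzero subspaces `Γ k`, and every `[Γ k, Γ l]` is contained in
some `Γ m`. -/
structure IsGrading (H : LieSubalgebra 𝕜 A) {ι : Type} (Γ : ι → Submodule 𝕜 A) : Prop where
  ne_bot : ∀ k, Γ k ≠ ⊥
  independent : iSupIndep Γ
  iSup_eq : ⨆ k, Γ k = H.toSubmodule
  bracket : ∀ k l, ∃ m, ∀ x ∈ Γ k, ∀ y ∈ Γ l, ⁅x, y⁆ ∈ Γ m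

/-- `d` labels the grading subspaces by pairwise different elements of the group `G` such that
`0 ≠ [Γ k, Γ l]` implies `[Γ k, Γ l] ⊆ Γ m` for the index `m` with label `d k * d l`. -/
def IsGroupLabelling {ι : Type} (Γ : ι → Submodule 𝕜 A) {G : Type} [Group G] (d : ι → G) : Prop :=
  Function.Injective d ∧
    ∀ k l, (∃ x ∈ Γ k, ∃ y ∈ Γ l, ⁅x, y⁆ ≠ 0) →
      ∃ m, d m = d k * d l ∧ ∀ x ∈ Γ k, ∀ y ∈ Γ l, ⁅x, y⁆ ∈ Γ m

/-- A group grading: a grading whose index set can be chosen as a subset of a group. -/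
def IsGroupGrading (H : LieSubalgebra 𝕜 A) {ι : Type} (Γ : ι → Submodule 𝕜 A) : Prop :=
  IsGrading H Γ ∧ ∃ (G : Type) (_ : Group G) (d : ι → G), IsGroupLabelling Γ d

/-- A group grading whose index set can be chosen as a subset of an Abelian group. -/
def IsAbelianGroupGrading (H : LieSubalgebra 𝕜 A) {ι : Type} (Γ : ι → Submodule 𝕜 A) : Prop :=
  IsGrading H Γ ∧ ∃ (G : Type) (_ : CommGroup G) (d : ι → G), IsGroupLabelling Γ d

/-- `Γ'` is a refinement of `Γ`: every `Γ k` is the sum of those `Γ' i` that are assigned to it. -/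
def IsRefinement {ι ι' : Type} (Γ : ι → Submodule 𝕜 A) (Γ' : ι' → Submodule 𝕜 A) : Prop :=
  ∃ f : ι' → ι, ∀ k, Γ k = ⨆ i : {i // f i = k}, Γ' i

/-- A fine group grading: a group grading that has no group refinement but itself. The labels of
`Γ` are taken in an Abelian group, while the labels of the refinements that are excluded may lie in
any group, so that this implies fineness with respect to either class of groups. -/
def IsFineGroupGrading (H : LieSubalgebra 𝕜 A) {ι : Type} (Γ : ι → Submodule 𝕜 A) : Prop :=
  IsAbelianGroupGrading H Γ ∧
    ∀ (ι' : Type) (Γ' : ι' → Submodule 𝕜 A),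
      IsGroupGrading H Γ' → IsRefinement Γ Γ' → Set.range Γ' = Set.range Γ

end Gradings

/-! ### The complex Lie algebras, and real forms -/

/-- Complex `4 × 4` matrices. -/
abbrev M4 : Type := Matrix (Fin 4) (Fin 4) ℂ

/-- `sl(4, ℂ)`. -/
abbrev sl4 : LieSubalgebra ℂ M4 := LieAlgebra.SpecialLinear.sl (Fin 4) ℂ

/-- `o_K(4, ℂ)`. -/
def oAlg (K : M4) : LieSubalgebra ℂ M4 where
  carrier := {X | X * K = -(K * Xᵀ)}
  add_mem' := by
    intro X Y hX hY
    change X * K = -(K * Xᵀ) at hX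
    change Y * K = -(K * Yᵀ) at hY
    change (X + Y) * K = -(K * (X + Y)ᵀ)
    rw [add_mul, hX, hY, transpose_add, mul_add, neg_add]
  zero_mem' := by simp
  smul_mem' := by
    intro c X hX
    change X * K = -(K * Xᵀ) at hX
    change (c • X) * K = -(K * (c • X)ᵀ)
    rw [smul_mul_assoc, hX, transpose_smul, mul_smul_comm, smul_neg]
  lie_mem' := by
    intro X Y hX hY
    change X * K = -(K * Xᵀ) at hX
    change Y * K = -(K * Yᵀ) at hY
    change ⁅X, Y⁆ * K = -(K * ⁅X, Y⁆ᵀ)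
    simp only [Ring.lie_def, sub_mul, transpose_sub, transpose_mul, mul_sub, Matrix.mul_assoc, hX,
      hY, mul_neg]
    simp only [← Matrix.mul_assoc, hX, hY, neg_mul, neg_neg, neg_sub]

/-- The real subalgebra `{X ∈ sl(4, ℂ) | X F = F X̄}`, the fixed points of `X ↦ conj (F⁻¹ X F)`
if `F` is invertible. -/
def suStar (F : M4) : LieSubalgebra ℝ M4 where
  carrier := {X | X.trace = 0 ∧ X * F = F * X.map (starRingEnd ℂ)}
  add_mem' := by
    rintro X Y ⟨tX, hX⟩ ⟨tY, hY⟩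
    refine ⟨by rw [trace_add, tX, tY, add_zero], ?_⟩
    rw [add_mul, hX, hY, Matrix.map_add _ (map_add _), mul_add]
  zero_mem' := by simp
  smul_mem' := by
    rintro c X ⟨tX, hX⟩
    refine ⟨by rw [trace_smul, tX, smul_zero], ?_⟩
    have h : (c • X).map (starRingEnd ℂ) = c • X.map (starRingEnd ℂ) := by
      ext i j; simp
    rw [smul_mul_assoc, hX, h, mul_smul_comm]
  lie_mem' := by
    rintro X Y ⟨tX, hX⟩ ⟨tY, hY⟩
    change _ ∧ _
    refine ⟨by rw [Ring.lie_def, trace_sub, trace_mul_comm, sub_self], ?_⟩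
    have h : (⁅X, Y⁆ : M4).map (starRingEnd ℂ) =
        X.map (starRingEnd ℂ) * Y.map (starRingEnd ℂ) -
          Y.map (starRingEnd ℂ) * X.map (starRingEnd ℂ) := by
      rw [Ring.lie_def, Matrix.map_sub _ (map_sub _), Matrix.map_mul, Matrix.map_mul]
    rw [h, Ring.lie_def, sub_mul, mul_sub, Matrix.mul_assoc, hY, ← Matrix.mul_assoc, hX,
      Matrix.mul_assoc, Matrix.mul_assoc Y, hX, ← Matrix.mul_assoc Y, hY, Matrix.mul_assoc]

/-- The real subalgebra `{X ∈ sl(4, ℂ) | X E = -E Xᴴ}`, the fixed points of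
`X ↦ conj (-(E⁻¹ X E)ᵀ)` if `E` is invertible and hermitian. -/
def su (E : M4) : LieSubalgebra ℝ M4 where
  carrier := {X | X.trace = 0 ∧ X * E = -(E * Xᴴ)}
  add_mem' := by
    rintro X Y ⟨tX, hX⟩ ⟨tY, hY⟩
    refine ⟨by rw [trace_add, tX, tY, add_zero], ?_⟩
    rw [add_mul, hX, hY, conjTranspose_add, mul_add, neg_add]
  zero_mem' := by simp
  smul_mem' := by
    rintro c X ⟨tX, hX⟩
    refine ⟨by rw [trace_smul, tX, smul_zero], ?_⟩
    rw [smul_mul_assoc, hX, conjTranspose_smul, star_trivial, mul_smul_comm, smul_neg]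
  lie_mem' := by
    rintro X Y ⟨tX, hX⟩ ⟨tY, hY⟩
    change _ ∧ _
    refine ⟨by rw [Ring.lie_def, trace_sub, trace_mul_comm, sub_self], ?_⟩
    simp only [Ring.lie_def, sub_mul, conjTranspose_sub, conjTranspose_mul, mul_sub,
      Matrix.mul_assoc, hX, hY, mul_neg]
    simp only [← Matrix.mul_assoc, hX, hY, neg_mul, neg_neg, neg_sub]

/-- `F` is anticircular; then `suStar F` is a representation of `su*(4)`. -/
def IsAnticircular (F : M4) : Prop := F * F.map (starRingEnd ℂ) = -1

/-- `E` is hermitian with `p` positive, no zero, and `q` negative eigenvalues, where `p + q = 4`;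
then `su E` is a representation of `su(p, q)`. -/
def HasSignature (E : M4) (p q : ℕ) : Prop :=
  p + q = 4 ∧ ∃ hE : E.IsHermitian,
    Nat.card {i // 0 < hE.eigenvalues i} = p ∧ Nat.card {i // hE.eigenvalues i < 0} = q

/-- `P` is a real form of `L`: every element of `L` is uniquely `u + i v` with `u, v ∈ P`. -/
def IsRealForm (L : LieSubalgebra ℂ M4) (P : LieSubalgebra ℝ M4) : Prop :=
  (∀ x ∈ P, x ∈ L) ∧
    ∀ x ∈ L, ∃! w : M4 × M4, w.1 ∈ P ∧ w.2 ∈ P ∧ x = w.1 + Complex.I • w.2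

/-- The real Lie algebra `o_K(4, ℂ) ∩ P`. -/
def oInter (K : M4) (P : LieSubalgebra ℝ M4) : LieSubalgebra ℝ M4 where
  carrier := {X | X ∈ oAlg K ∧ X ∈ P}
  add_mem' := fun hX hY => ⟨add_mem hX.1 hY.1, add_mem hX.2 hY.2⟩
  zero_mem' := ⟨zero_mem _, zero_mem _⟩
  smul_mem' := by
    intro c X hX
    refine ⟨?_, P.smul_mem c hX.2⟩
    have h := (oAlg K).smul_mem (c : ℂ) hX.1
    rwa [Complex.coe_smul] at h
  lie_mem' := fun hX hY => ⟨(oAlg K).lie_mem hX.1 hY.1, P.lie_mem hX.2 hY.2⟩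

/-! ### The standard models of the real forms of `o(4, ℂ)` -/

/-- `so(p, q)`, the real matrices that are skew-adjoint for `diag(1, …, 1, -1, …, -1)`. -/
abbrev soReal (p q : ℕ) : LieSubalgebra ℝ (Matrix (Fin p ⊕ Fin q) (Fin p ⊕ Fin q) ℝ) :=
  LieAlgebra.Orthogonal.so' (Fin p) (Fin q) ℝ

/-- `so*(4)`, the complex matrices with `Xᵀ = -X` and `Xᴴ J + J X = 0`, where `J` is the standard
symplectic matrix. -/
def soStar : LieSubalgebra ℝ (Matrix (Fin 2 ⊕ Fin 2) (Fin 2 ⊕ Fin 2) ℂ) where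
  carrier := {X | Xᵀ = -X ∧ Xᴴ * Matrix.J (Fin 2) ℂ + Matrix.J (Fin 2) ℂ * X = 0}
  add_mem' := by
    rintro X Y ⟨sX, hX⟩ ⟨sY, hY⟩
    refine ⟨by rw [transpose_add, sX, sY, neg_add], ?_⟩
    rw [conjTranspose_add, add_mul, mul_add, add_add_add_comm, hX, hY, add_zero]
  zero_mem' := by simp
  smul_mem' := by
    rintro c X ⟨sX, hX⟩
    refine ⟨by rw [transpose_smul, sX, smul_neg], ?_⟩
    rw [conjTranspose_smul, star_trivial, smul_mul_assoc, mul_smul_comm, ← smul_add, hX, smul_zero]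
  lie_mem' := by
    rintro X Y ⟨sX, hX⟩ ⟨sY, hY⟩
    change _ ∧ _
    refine ⟨by simp only [Ring.lie_def, transpose_sub, transpose_mul, sX, sY]; noncomm_ring, ?_⟩
    rw [add_eq_zero_iff_eq_neg] at hX hY
    simp only [Ring.lie_def, mul_sub, conjTranspose_sub, conjTranspose_mul, sub_mul,
      Matrix.mul_assoc, hX, hY, mul_neg]
    simp only [← Matrix.mul_assoc, hX, hY, neg_mul, neg_neg]
    abel

/-! ### The gradings `Γ₃, …, Γ₈` of `sl(4, ℂ)`

The grading subspace `L_k` is the value at the index `k - 1`. -/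

/-- The matrix unit `E_{jk}`, with `j, k ∈ {1, 2, 3, 4}`. -/
def e (j k : ℕ) : M4 := Matrix.of fun a b => if a.val + 1 = j ∧ b.val + 1 = k then 1 else 0

/-- The complex span of a set of matrices. -/
abbrev sp (s : Set M4) : Submodule ℂ M4 := Submodule.span ℂ s

def Γ₃ : Fin 13 → Submodule ℂ M4 :=
  ![sp {e 1 4 + e 4 1}, sp {e 1 4 - e 4 1}, sp {e 2 4 + e 4 2}, sp {e 2 4 - e 4 2},
    sp {e 3 4 + e 4 3}, sp {e 3 4 - e 4 3}, sp {e 1 3 + e 3 1}, sp {e 1 3 - e 3 1},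
    sp {e 2 3 + e 3 2}, sp {e 2 3 - e 3 2}, sp {e 1 2 + e 2 1}, sp {e 1 2 - e 2 1},
    sp {e 1 1 - e 2 2, e 2 2 - e 3 3, e 3 3 - e 4 4}]

def Γ₄ : Fin 14 → Submodule ℂ M4 :=
  ![sp {e 1 3 - e 4 1}, sp {e 1 3 + e 4 1}, sp {e 1 4 - e 3 1}, sp {e 1 4 + e 3 1},
    sp {e 2 4 - e 3 2}, sp {e 2 4 + e 3 2}, sp {e 2 3 - e 4 2}, sp {e 2 3 + e 4 2},
    sp {e 1 2 - e 2 1}, sp {e 1 2 + e 2 1}, sp {e 3 4}, sp {e 4 3},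
    sp {e 3 3 - e 4 4}, sp {e 1 1 - e 2 2, e 1 1 + e 2 2 - e 3 3 - e 4 4}]

def Γ₅ : Fin 14 → Submodule ℂ M4 :=
  ![sp {e 2 3 - e 4 1}, sp {e 2 3 + e 4 1}, sp {e 2 4 - e 3 1}, sp {e 2 4 + e 3 1},
    sp {e 1 3 - e 4 2}, sp {e 1 3 + e 4 2}, sp {e 1 4 - e 3 2}, sp {e 1 4 + e 3 2},
    sp {e 1 2}, sp {e 2 1}, sp {e 3 4}, sp {e 4 3},
    sp {e 1 1 + e 2 2 - e 3 3 - e 4 4},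
    sp {e 1 1 - e 2 2 + e 3 3 - e 4 4, e 1 1 - e 2 2 - e 3 3 + e 4 4}]

def Γ₆ : Fin 15 → Submodule ℂ M4 :=
  ![sp {e 1 1 - e 2 2 + e 3 3 - e 4 4}, sp {e 1 1 - e 2 2 - e 3 3 + e 4 4},
    sp {e 1 1 + e 2 2 - e 3 3 - e 4 4}, sp {e 1 3 - e 2 4 + e 3 1 - e 4 2},
    sp {e 1 3 + e 2 4 - e 3 1 - e 4 2}, sp {e 1 3 + e 2 4 + e 3 1 + e 4 2},
    sp {e 1 3 - e 2 4 - e 3 1 + e 4 2}, sp {e 2 1 + e 4 3}, sp {e 2 1 - e 4 3},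
    sp {e 1 4 - e 3 2}, sp {e 1 4 + e 3 2}, sp {e 2 3 - e 4 1}, sp {e 2 3 + e 4 1},
    sp {e 1 2 + e 3 4}, sp {e 1 2 - e 3 4}]

def Γ₇ : Fin 15 → Submodule ℂ M4 :=
  ![sp {e 1 4 + e 2 3 + e 3 2 + e 4 1}, sp {e 1 4 - e 2 3 - e 3 2 + e 4 1},
    sp {e 1 4 - e 2 3 + e 3 2 - e 4 1}, sp {e 1 4 + e 2 3 - e 3 2 - e 4 1},
    sp {e 1 3 + e 2 4 + e 3 1 + e 4 2}, sp {e 1 3 - e 2 4 - e 3 1 + e 4 2},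
    sp {e 1 3 - e 2 4 + e 3 1 - e 4 2}, sp {e 1 3 + e 2 4 - e 3 1 - e 4 2},
    sp {e 1 2 + e 2 1 + e 3 4 + e 4 3}, sp {e 1 2 - e 2 1 - e 3 4 + e 4 3},
    sp {e 1 2 - e 2 1 + e 3 4 - e 4 3}, sp {e 1 2 + e 2 1 - e 3 4 - e 4 3},
    sp {e 1 1 - e 2 2 - e 3 3 + e 4 4}, sp {e 1 1 - e 2 2 + e 3 3 - e 4 4},
    sp {e 1 1 + e 2 2 - e 3 3 - e 4 4}]

def Γ₈ : Fin 14 → Submodule ℂ M4 :=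
  ![sp {e 1 3 + e 2 4 + e 3 2 + e 4 1}, sp {e 1 3 - e 2 4 - e 3 2 + e 4 1},
    sp {e 1 3 - e 2 4 + e 3 2 - e 4 1}, sp {e 1 3 + e 2 4 - e 3 2 - e 4 1},
    sp {e 1 4 + e 2 3 + e 3 1 + e 4 2}, sp {e 1 4 - e 2 3 - e 3 1 + e 4 2},
    sp {e 1 4 - e 2 3 + e 3 1 - e 4 2}, sp {e 1 4 + e 2 3 - e 3 1 - e 4 2},
    sp {e 1 1 + e 2 2 - e 3 3 - e 4 4}, sp {e 1 1 - e 2 2}, sp {e 3 3 - e 4 4},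
    sp {e 1 2 - e 2 1}, sp {e 3 4 - e 4 3}, sp {e 1 2 + e 2 1, e 3 4 + e 4 3}]

/-! The grading subspaces that make up `o_K(4, ℂ)` (again `L_k` has the index `k - 1`). -/

/-- `L₂, L₄, L₆, L₈, L₁₀, L₁₂`. -/
def S₃ : Set (Fin 13) := {1, 3, 5, 7, 9, 11}

/-- `L₁₃, L₁, L₅, L₉, L₇, L₃`. -/
def S₄ : Set (Fin 14) := {12, 0, 4, 8, 6, 2}

/-- `L₁₄, L₁, L₃, L₅, L₇`. -/
def S₅ : Set (Fin 14) := {13, 0, 2, 4, 6}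

/-- `L₁, L₂, L₁₀, L₄, L₅, L₁₂`. -/
def S₆ : Set (Fin 15) := {0, 1, 9, 3, 4, 11}

/-- `L₃, L₄, L₈, L₆, L₁₁, L₁₀`. -/
def S₇ : Set (Fin 15) := {2, 3, 7, 5, 10, 9}

/-- `L₁₁, L₄, L₃, L₁₂, L₈, L₆`. -/
def S₈ : Set (Fin 14) := {10, 3, 2, 11, 7, 5}

/-! ### The defining matrices -/

def K₁ : M4 := 1

def K₂ : M4 := !![1, 0, 0, 0; 0, 1, 0, 0; 0, 0, 0, 1; 0, 0, 1, 0]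

def K₃ : M4 := !![0, 1, 0, 0; 1, 0, 0, 0; 0, 0, 0, 1; 0, 0, 1, 0]

def F₁ : M4 := !![0, 0, 1, 0; 0, 0, 0, 1; -1, 0, 0, 0; 0, -1, 0, 0]

def F₂ : M4 :=
  !![0, 1, 0, 0; -1, 0, 0, 0; 0, 0, 0, Complex.I; 0, 0, -Complex.I, 0]

def E40₁ : M4 := 1

def E31₁ : M4 := !![1, 0, 0, 0; 0, 1, 0, 0; 0, 0, 1, 0; 0, 0, 0, -1]

def E31₂ : M4 := !![1, 0, 0, 0; 0, 1, 0, 0; 0, 0, 0, 1; 0, 0, 1, 0]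

def E22₁ : M4 := !![1, 0, 0, 0; 0, 1, 0, 0; 0, 0, -1, 0; 0, 0, 0, -1]

def E22₂ : M4 := !![1, 0, 0, 0; 0, -1, 0, 0; 0, 0, 0, 1; 0, 0, 1, 0]

def E22₃ : M4 := !![0, 1, 0, 0; 1, 0, 0, 0; 0, 0, 0, 1; 0, 0, 1, 0]

def E22₅ : M4 :=
  !![1, 0, 0, 0; 0, -1, 0, 0; 0, 0, 0, Complex.I; 0, 0, -Complex.I, 0]

/-! ### Gradings of real forms that are displayed by a grading of `sl(4, ℂ)` -/

/-- The real subspaces `L_k ∩ P`. -/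
def realPart {ι : Type} (Γ : ι → Submodule ℂ M4) (P : LieSubalgebra ℝ M4) (k : ι) :
    Submodule ℝ M4 :=
  (Γ k).restrictScalars ℝ ⊓ P.toSubmodule

/-- The fine group grading `Γ` of `sl(4, ℂ)` determines the fine group grading `(L_k ∩ P)_k` of
the real form `P`: each `L_k` has a complex basis in `P`. -/
structure Determines {ι : Type} (Γ : ι → Submodule ℂ M4) (P : LieSubalgebra ℝ M4) : Prop where
  fine_complex : IsFineGroupGrading sl4 Γ
  realForm : IsRealForm sl4 P
  span_eq : ∀ k, Submodule.span ℂ (realPart Γ P k : Set M4) = Γ k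
  fine_real : IsFineGroupGrading P (realPart Γ P)

/-- The grading `(L_k ∩ P)_k` of `P` displays the real form `o_K(4, ℂ) ∩ P` of `o_K(4, ℂ)`, which is
isomorphic to `R`: this subalgebra is the sum of the grading subspaces with index in `S`, and they
form a fine group grading of it. -/
structure Displays {ι : Type} (Γ : ι → Submodule ℂ M4) (S : Set ι) (K : M4)
    (P : LieSubalgebra ℝ M4) (R : Type) [LieRing R] [LieAlgebra ℝ R] : Prop where
  determines : Determines Γ P
  symm : Kᵀ = K
  det_ne_zero : K.det ≠ 0
  realForm : IsRealForm (oAlg K) (oInter K P)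
  iso : Nonempty (oInter K P ≃ₗ⁅ℝ⁆ R)
  display_complex : (oAlg K).toSubmodule = ⨆ k : S, Γ k
  display : (oInter K P).toSubmodule = ⨆ k : S, realPart Γ P k
  fine : IsFineGroupGrading (oInter K P) (fun k : S => realPart Γ P k)

end FineGradings

end

open Matrix

attribute [local instance 100] LieRing.ofAssociativeRing

noncomputable section

namespace FineGradings

/-! ### Group gradings and their refinements -/

section Refinements

variable {𝕜 A : Type} [Field 𝕜] [LieRing A] [LieAlgebra 𝕜 A]

/-! Each of the six decompositions consists of the simultaneous eigenspaces of a few automorphisms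
`X ↦ A X A⁻¹` and `X ↦ -A Xᵀ A⁻¹`. Eigenvalues multiply under the bracket, so the tuples of
eigenvalues label the components by elements of an Abelian group (`IsFrame.isAbelianGroupGrading`).

Fineness: a refinement cannot break a line, so only the one component of dimension two or three, if
there is one, could split. The lines survive in every group refinement and keep labels there. A
homogeneous element that maps a line with label `g` onto a line with label `h` has label `h g⁻¹`. If
any two nonzero elements of the thick component act on lines in a way that forces equal labels, all
its pieces coincide (`isFineGroupGrading_of_isUnsplittable`).

Real forms: `P` is the fixed set of an antilinear involution, and every basis element lies in `P`
after multiplication by a suitable scalar. Since `P` contains no complex line, `L_k ∩ P` is the real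
span of the rescaled basis elements, and labels and rigidity descend to `P`
(`IsDisplayFrame.displays`).

Displayed subalgebras: `o_K` is the `-1` eigenspace of `X ↦ K Xᵀ K`. Every basis element is an
eigenvector of this involution, so `o_K` is a sum of components (`IsDisplayFrame.oAlg_eq_span`). It
is identified with the standard real form by a change of basis that normalizes `K` together with `E`
or `F` (`nonempty_lieEquiv_soReal`, `nonempty_lieEquiv_soStar`).

The matrices can all be taken over the Gaussian integers, where equality is decidable; the finite
verifications are done by evaluation there. -/

/-- `V` is one-dimensional. -/
def IsLine (V : Submodule 𝕜 A) : Prop := ∃ x, x ≠ 0 ∧ V = Submodule.span 𝕜 {x}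

/-- `ad u` maps the line `Γ l` onto the line `Γ m`. -/
def Moves {ι : Type} (Γ : ι → Submodule 𝕜 A) (u : A) (l m : ι) : Prop :=
  IsLine (Γ l) ∧ IsLine (Γ m) ∧ ∃ x ∈ Γ l, ⁅u, x⁆ ≠ 0 ∧ ⁅u, x⁆ ∈ Γ m

/-- A sufficient condition for `Γ k` to be a homogeneous component of every group grading that
refines `Γ`: if it is not a line, the action of any two of its nonzero elements on the lines
forces their labels to agree. -/
def IsUnsplittable {ι : Type} (Γ : ι → Submodule 𝕜 A) (k : ι) : Prop :=
  IsLine (Γ k) ∨ ∀ u ∈ Γ k, ∀ v ∈ Γ k, u ≠ 0 → v ≠ 0 →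
    ∃ l m l' m', Moves Γ u l m ∧ Moves Γ v l' m' ∧ (l = l' ∧ m = m' ∨ l = m ∧ l' = m')

theorem eq_of_mem_of_mem {ι : Type} {Γ : ι → Submodule 𝕜 A} (h : iSupIndep Γ) {i j : ι} {x : A}
    (hx : x ≠ 0) (hi : x ∈ Γ i) (hj : x ∈ Γ j) : i = j := by
  by_contra hij
  exact hx (Submodule.disjoint_def.1 (h.pairwiseDisjoint hij) x hi hj)

theorem IsLine.eq_of_le {V W : Submodule 𝕜 A} (hV : IsLine V) (hW : W ≠ ⊥) (h : W ≤ V) :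
    W = V := by
  obtain ⟨x, -, rfl⟩ := hV
  refine le_antisymm h ?_
  obtain ⟨y, hy, hy0⟩ := Submodule.exists_mem_ne_zero_of_ne_bot hW
  obtain ⟨c, rfl⟩ := Submodule.mem_span_singleton.1 (h hy)
  have hc : c ≠ 0 := by rintro rfl; simp at hy0
  rw [Submodule.span_singleton_le_iff_mem]
  simpa [smul_smul, hc] using W.smul_mem c⁻¹ hy

/-- Two refined pieces inside one component get the same label, hence are equal, so the assignment
`f` is a bijection. Only right cancellation in the group is used, which is why non-Abelian
refinements are excluded as well. -/
theorem isFineGroupGrading_of_isUnsplittable {H : LieSubalgebra 𝕜 A} {ι : Type}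
    {Γ : ι → Submodule 𝕜 A} (hΓ : IsAbelianGroupGrading H Γ) (hu : ∀ k, IsUnsplittable Γ k) :
    IsFineGroupGrading H Γ := by
  refine ⟨hΓ, ?_⟩
  rintro ι' Γ' ⟨hg, G, _, d, dinj, hd⟩ ⟨f, hf⟩
  have hle : ∀ i, Γ' i ≤ Γ (f i) := fun i => by
    rw [hf (f i)]
    exact le_iSup (fun i' : {i' // f i' = f i} => Γ' i') ⟨i, rfl⟩
  have hsurj : ∀ k, ∃ i, f i = k := by
    intro k
    by_contra! hk
    refine hΓ.1.ne_bot k ?_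
    have : IsEmpty {i // f i = k} := ⟨fun i => hk i i.2⟩
    rw [hf k, iSup_of_empty]
  -- A line is itself a component of the refinement; for other `l` the choice of `p` is irrelevant.
  have hline : ∀ l, ∃ p, IsLine (Γ l) → Γ' p = Γ l := by
    intro l
    obtain ⟨p, rfl⟩ := hsurj l
    exact ⟨p, fun h => h.eq_of_le (hg.ne_bot p) (hle p)⟩
  choose p hp using hline
  have hlabel : ∀ i u l m, u ∈ Γ' i → Moves Γ u l m → d (p m) = d i * d (p l) := by
    rintro i u l m hui ⟨hl, hm, x, hx, h0, hxm⟩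
    rw [← hp l hl] at hx
    rw [← hp m hm] at hxm
    obtain ⟨q, hq, hqb⟩ := hd i (p l) ⟨u, hui, x, hx, h0⟩
    rw [← hq, eq_of_mem_of_mem hg.independent h0 hxm (hqb u hui x hx)]
  have hinj : Function.Injective f := by
    intro i j hij
    obtain ⟨u, hu', hu0⟩ := Submodule.exists_mem_ne_zero_of_ne_bot (hg.ne_bot i)
    obtain ⟨v, hv', hv0⟩ := Submodule.exists_mem_ne_zero_of_ne_bot (hg.ne_bot j)
    have huk := hle i hu'
    have hvk := hle j hv'
    rcases hu (f i) with hl | hk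
    · refine eq_of_mem_of_mem hg.independent hu0 hu' ?_
      rwa [hl.eq_of_le (hg.ne_bot j) (by rw [hij]; exact hle j)]
    · rw [← hij] at hvk
      obtain ⟨l, m, l', m', h, h', hlm⟩ := hk u huk v hvk hu0 hv0
      have e₁ := hlabel i u l m hu' h
      have e₂ := hlabel j v l' m' hv' h'
      apply dinj
      rcases hlm with ⟨rfl, rfl⟩ | ⟨rfl, rfl⟩
      · exact mul_right_cancel (e₁.symm.trans e₂)
      -- Both elements map a line onto itself, so both labels are the identity of the group.
      · rw [right_eq_mul] at e₁ e₂
        rw [e₁, e₂]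
  have heq : ∀ i, Γ (f i) = Γ' i := by
    intro i
    refine le_antisymm ?_ (hle i)
    rw [hf (f i)]
    exact iSup_le fun j => by rw [hinj j.2]
  ext V
  constructor
  · rintro ⟨i, rfl⟩
    exact ⟨f i, heq i⟩
  · rintro ⟨k, rfl⟩
    obtain ⟨i, rfl⟩ := hsurj k
    exact ⟨i, (heq i).symm⟩

/-- A part of a group grading that spans a subalgebra is a group grading of it. -/
theorem IsAbelianGroupGrading.restrict {H H' : LieSubalgebra 𝕜 A} {ι : Type}
    {Γ : ι → Submodule 𝕜 A} (hΓ : IsAbelianGroupGrading H Γ) {S : Set ι} (hS : S.Nonempty)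
    (hH' : H'.toSubmodule = ⨆ k : S, Γ k) : IsAbelianGroupGrading H' (fun k : S => Γ k) := by
  obtain ⟨hg, G, _, d, dinj, hd⟩ := hΓ
  have hle : ∀ k : S, Γ k ≤ H'.toSubmodule := fun k => by
    rw [hH']
    exact le_iSup (fun k : S => Γ k) k
  -- By independence, a component outside `S` meets the sum over `S` only in zero; so nonzero
  -- brackets keep their target index in `S`.
  have hmem : ∀ m x, x ≠ 0 → x ∈ Γ m → x ∈ H' → m ∈ S := by
    intro m x hx hm hxH
    by_contra hmS
    refine hx (Submodule.disjoint_def.1 (hg.independent m) x hm ?_)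
    have : x ∈ ⨆ k : S, Γ k := hH' ▸ hxH
    refine (iSup_le fun k : S => ?_ : ⨆ k : S, Γ k ≤ _) this
    exact le_iSup₂_of_le (f := fun j (_ : j ≠ m) => Γ j) k.1 (fun h => hmS (h ▸ k.2)) le_rfl
  have hbr : ∀ k l : S, (∃ x ∈ Γ k, ∃ y ∈ Γ l, ⁅x, y⁆ ≠ 0) →
      ∃ m : S, d m = d k * d l ∧ ∀ x ∈ Γ k, ∀ y ∈ Γ l, ⁅x, y⁆ ∈ Γ m := by
    intro k l h
    obtain ⟨m, hm, hmb⟩ := hd k l h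
    obtain ⟨x, hx, y, hy, hxy⟩ := h
    exact ⟨⟨m, hmem m _ hxy (hmb x hx y hy) (H'.lie_mem (hle k hx) (hle l hy))⟩, hm, hmb⟩
  refine ⟨⟨fun k => hg.ne_bot k, hg.independent.comp Subtype.val_injective, hH'.symm, ?_⟩, G, _,
    fun k => d k, dinj.comp Subtype.val_injective, hbr⟩
  intro k l
  by_cases h : ∃ x ∈ Γ k, ∃ y ∈ Γ l, ⁅x, y⁆ ≠ 0
  · obtain ⟨m, -, hm⟩ := hbr k l h
    exact ⟨m, hm⟩
  · push Not at h
    obtain ⟨m, hm⟩ := hS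
    refine ⟨⟨m, hm⟩, fun x hx y hy => ?_⟩
    rw [h x hx y hy]
    exact zero_mem _

/-- The family `b` is linearly independent, and the spaces `Γ k` are spanned by the parts of `b`
given by `κ`. -/
structure IsFrame {ι n : Type} (Γ : ι → Submodule 𝕜 A) (b : n → A) (κ : n → ι) : Prop where
  linearIndependent : LinearIndependent 𝕜 b
  eq_span : ∀ k, Γ k = Submodule.span 𝕜 (b '' (κ ⁻¹' {k}))
  surjective : Function.Surjective κ

/-! ### Decompositions given by a partition of a linearly independent family -/

namespace IsFrame

variable {ι n : Type} {Γ : ι → Submodule 𝕜 A} {b : n → A} {κ : n → ι}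

theorem mem (h : IsFrame Γ b κ) (i : n) : b i ∈ Γ (κ i) := by
  rw [h.eq_span]
  exact Submodule.subset_span ⟨i, rfl, rfl⟩

theorem ne_bot (h : IsFrame Γ b κ) (k : ι) : Γ k ≠ ⊥ := by
  obtain ⟨i, rfl⟩ := h.surjective k
  intro hb
  exact h.linearIndependent.ne_zero i ((Submodule.mem_bot 𝕜).1 (hb ▸ h.mem i))

theorem iSup_subtype (h : IsFrame Γ b κ) (S : Set ι) :
    ⨆ k : S, Γ k = Submodule.span 𝕜 (b '' (κ ⁻¹' S)) := by
  refine le_antisymm (iSup_le fun k => ?_) (Submodule.span_le.2 ?_)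
  · rw [h.eq_span]
    refine Submodule.span_mono (Set.image_mono fun i hi => ?_)
    rw [Set.mem_preimage, Set.mem_singleton_iff] at hi
    rw [Set.mem_preimage, hi]
    exact k.2
  · rintro _ ⟨i, hi, rfl⟩
    exact Submodule.mem_iSup_of_mem (p := fun k : S => Γ k) ⟨κ i, hi⟩ (h.mem i)

theorem iSup_eq (h : IsFrame Γ b κ) : ⨆ k, Γ k = Submodule.span 𝕜 (Set.range b) := by
  rw [← Set.image_univ, ← Set.preimage_univ (f := κ), ← h.iSup_subtype Set.univ]
  exact (Equiv.Set.univ ι).iSup_congr (fun _ => rfl) |>.symm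

theorem iSupIndep (h : IsFrame Γ b κ) : iSupIndep Γ := by
  intro k
  have : ⨆ j, ⨆ (_ : j ≠ k), Γ j = Submodule.span 𝕜 (b '' (κ ⁻¹' {j | j ≠ k})) := by
    rw [← h.iSup_subtype, iSup_subtype']
    rfl
  rw [this, h.eq_span]
  refine h.linearIndependent.disjoint_span_image (Disjoint.preimage κ ?_)
  simp

theorem isLine (h : IsFrame Γ b κ) {i : n} (hi : ∀ j, κ j = κ i → j = i) : IsLine (Γ (κ i)) := by
  refine ⟨b i, h.linearIndependent.ne_zero i, ?_⟩
  rw [h.eq_span]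
  congr 1
  ext x
  constructor
  · rintro ⟨j, hj, rfl⟩
    rw [hi j hj]
    rfl
  · rintro rfl
    exact ⟨i, rfl, rfl⟩

/-- This permits moving the basis elements into a real form without changing the complex components.
-/
theorem smul (h : IsFrame Γ b κ) {c : n → 𝕜} (hc : ∀ i, c i ≠ 0) :
    IsFrame Γ (fun i => c i • b i) κ := by
  refine ⟨h.linearIndependent.units_smul fun i => Units.mk0 (c i) (hc i), fun k => ?_,
    h.surjective⟩
  rw [h.eq_span]
  refine le_antisymm (Submodule.span_le.2 ?_) (Submodule.span_le.2 ?_)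
  · rintro _ ⟨i, hi, rfl⟩
    have := Submodule.smul_mem _ (c i)⁻¹ (Submodule.subset_span (R := 𝕜)
      (Set.mem_image_of_mem (fun i => c i • b i) hi))
    simpa [smul_smul, hc i] using this
  · rintro _ ⟨i, hi, rfl⟩
    exact Submodule.smul_mem _ _ (Submodule.subset_span ⟨i, hi, rfl⟩)

/-- A decomposition into simultaneous eigenspaces of endomorphisms of the Lie algebra is graded
by the eigenvalues. -/
theorem isAbelianGroupGrading [Fintype n] (h : IsFrame Γ b κ) {H : LieSubalgebra 𝕜 A}
    (hH : Submodule.span 𝕜 (Set.range b) = H.toSubmodule) {σ : Type} (φ : σ → A →ₗ⁅𝕜⁆ A)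
    {χ : ι → σ → 𝕜ˣ} (hχ : Function.Injective χ)
    (hφ : ∀ s i, φ s (b i) = (χ (κ i) s : 𝕜) • b i) : IsAbelianGroupGrading H Γ := by
  have heig : ∀ k x, x ∈ Γ k → ∀ s, φ s x = (χ k s : 𝕜) • x := by
    intro k x hx s
    rw [h.eq_span] at hx
    induction hx using Submodule.span_induction with
    | mem x hx =>
      obtain ⟨i, hi, rfl⟩ := hx
      rw [Set.mem_preimage, Set.mem_singleton_iff] at hi
      rw [hφ, hi]
    | zero => simp
    | add x y _ _ hx hy => rw [map_add, hx, hy, smul_add]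
    | smul c x _ hx => rw [map_smul, hx, smul_comm]
  -- Applying `φ s` to the expansion of the bracket and comparing coefficients leaves only basis
  -- elements whose character is `χ k * χ l`.
  have hcomp : ∀ k l x y, x ∈ Γ k → y ∈ Γ l → ∃ c : n → 𝕜, ∑ i, c i • b i = ⁅x, y⁆ ∧
      ∀ i, c i ≠ 0 → χ (κ i) = χ k * χ l := by
    intro k l x y hx hy
    have hle : ∀ k, Γ k ≤ H.toSubmodule := fun k => by
      rw [← hH, ← h.iSup_eq]
      exact le_iSup Γ k
    have hxy : ⁅x, y⁆ ∈ Submodule.span 𝕜 (Set.range b) := by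
      rw [hH]
      exact H.lie_mem (hle k hx) (hle l hy)
    obtain ⟨c, hc⟩ := (Submodule.mem_span_range_iff_exists_fun 𝕜).1 hxy
    refine ⟨c, hc, fun i hi => funext fun s => Units.ext ?_⟩
    have h₁ : φ s ⁅x, y⁆ = ((χ k s : 𝕜) * χ l s) • ⁅x, y⁆ := by
      rw [LieHom.map_lie, heig k x hx, heig l y hy, smul_lie, lie_smul, smul_smul]
    have h₂ : ∑ i, (c i * ((χ (κ i) s : 𝕜) - χ k s * χ l s)) • b i = 0 := by
      rw [← hc, map_sum, Finset.smul_sum, ← sub_eq_zero, ← Finset.sum_sub_distrib] at h₁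
      rw [← h₁]
      refine Finset.sum_congr rfl fun i _ => ?_
      rw [map_smul, hφ, smul_smul, smul_smul, ← sub_smul]
      congr 1
      ring
    have h₃ := Fintype.linearIndependent_iff.1 h.linearIndependent _ h₂ i
    simpa [hi, sub_eq_zero] using h₃
  have hbr : ∀ k l m, χ m = χ k * χ l → ∀ x ∈ Γ k, ∀ y ∈ Γ l, ⁅x, y⁆ ∈ Γ m := by
    intro k l m hm x hx y hy
    obtain ⟨c, hc, hcχ⟩ := hcomp k l x y hx hy
    rw [← hc]
    refine Submodule.sum_mem _ fun i _ => ?_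
    by_cases hi : c i = 0
    · simp [hi]
    · have : κ i = m := hχ ((hcχ i hi).trans hm.symm)
      exact Submodule.smul_mem _ _ (this ▸ h.mem i)
  have hex : ∀ k l, (∃ x ∈ Γ k, ∃ y ∈ Γ l, ⁅x, y⁆ ≠ 0) → ∃ m, χ m = χ k * χ l := by
    rintro k l ⟨x, hx, y, hy, hxy⟩
    obtain ⟨c, hc, hcχ⟩ := hcomp k l x y hx hy
    by_contra! hne
    refine hxy ?_
    rw [← hc]
    refine Finset.sum_eq_zero fun i _ => ?_
    by_cases hi : c i = 0
    · simp [hi]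
    · exact absurd (hcχ i hi) (hne _)
  refine ⟨⟨h.ne_bot, h.iSupIndep, h.iSup_eq.trans hH, fun k l => ?_⟩, σ → 𝕜ˣ, inferInstance, χ,
    hχ, fun k l hkl => ?_⟩
  · by_cases hkl : ∃ x ∈ Γ k, ∃ y ∈ Γ l, ⁅x, y⁆ ≠ 0
    · obtain ⟨m, hm⟩ := hex k l hkl
      exact ⟨m, hbr k l m hm⟩
    · push Not at hkl
      refine ⟨k, fun x hx y hy => ?_⟩
      rw [hkl x hx y hy]
      exact zero_mem _
  · obtain ⟨m, hm⟩ := hex k l hkl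
    exact ⟨m, hm, hbr k l m hm⟩

end IsFrame

end Refinements

/-! ### Real forms given by bases -/

/-- The real subalgebra `P` contains no complex line. -/
def IsTotallyReal (P : LieSubalgebra ℝ M4) : Prop := ∀ x ∈ P, Complex.I • x ∈ P → x = 0

theorem exists_add_I_smul_of_mem_span {s : Set M4} {x : M4} (hx : x ∈ Submodule.span ℂ s) :
    ∃ u ∈ Submodule.span ℝ s, ∃ v ∈ Submodule.span ℝ s, x = u + Complex.I • v := by
  induction hx using Submodule.span_induction with
  | mem x hx => exact ⟨x, Submodule.subset_span hx, 0, zero_mem _, by simp⟩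
  | zero => exact ⟨0, zero_mem _, 0, zero_mem _, by simp⟩
  | add x y _ _ hx hy =>
    obtain ⟨u, hu, v, hv, rfl⟩ := hx
    obtain ⟨u', hu', v', hv', rfl⟩ := hy
    exact ⟨u + u', add_mem hu hu', v + v', add_mem hv hv', by rw [smul_add]; abel⟩
  | smul c x _ hx =>
    obtain ⟨u, hu, v, hv, rfl⟩ := hx
    refine ⟨c.re • u - c.im • v, sub_mem (Submodule.smul_mem _ _ hu) (Submodule.smul_mem _ _ hv),
      c.im • u + c.re • v, add_mem (Submodule.smul_mem _ _ hu) (Submodule.smul_mem _ _ hv), ?_⟩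
    simp only [← Complex.coe_smul]
    nth_rw 1 [← Complex.re_add_im c]
    have hI := Complex.I_mul_I
    ext i j
    simp only [Matrix.smul_apply, Matrix.add_apply, Matrix.sub_apply, smul_eq_mul]
    linear_combination (c.im : ℂ) * v i j * hI

theorem span_real_le {P : LieSubalgebra ℝ M4} {s : Set M4} (hs : s ⊆ P) :
    Submodule.span ℝ s ≤ P.toSubmodule := Submodule.span_le.2 hs

theorem IsTotallyReal.eq_and_eq {P : LieSubalgebra ℝ M4} (hP : IsTotallyReal P) {u v u' v' : M4}
    (hu : u ∈ P) (hv : v ∈ P) (hu' : u' ∈ P) (hv' : v' ∈ P)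
    (h : u + Complex.I • v = u' + Complex.I • v') : u = u' ∧ v = v' := by
  have h₁ : Complex.I • (v - v') = u' - u := by
    rw [smul_sub, sub_eq_sub_iff_add_eq_add, add_comm, h, add_comm]
  have h₂ : v = v' := sub_eq_zero.1 (hP _ (sub_mem hv hv') (h₁ ▸ sub_mem hu' hu))
  subst h₂
  exact ⟨add_right_cancel h, rfl⟩

/-- Write `x = u + i v` with `u`, `v` in the real span; uniqueness of such a decomposition within
`P` forces `v = 0`. This identifies `L_k ∩ P` without counting dimensions. -/
theorem IsTotallyReal.mem_span_real {P : LieSubalgebra ℝ M4} (hP : IsTotallyReal P) {s : Set M4}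
    (hs : s ⊆ P) {x : M4} (hxP : x ∈ P) (hx : x ∈ Submodule.span ℂ s) :
    x ∈ Submodule.span ℝ s := by
  obtain ⟨u, hu, v, hv, h⟩ := exists_add_I_smul_of_mem_span hx
  have := hP.eq_and_eq hxP (zero_mem _) (span_real_le hs hu) (span_real_le hs hv)
    (by rwa [smul_zero, add_zero])
  rwa [this.1]

theorem span_real_eq {L : LieSubalgebra ℂ M4} {P : LieSubalgebra ℝ M4} (hP : IsTotallyReal P)
    (hPL : ∀ x ∈ P, x ∈ L) {s : Set M4} (hs : s ⊆ P)
    (hL : L.toSubmodule = Submodule.span ℂ s) : P.toSubmodule = Submodule.span ℝ s := by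
  refine le_antisymm (fun x hx => hP.mem_span_real hs hx ?_) (span_real_le hs)
  rw [← hL]
  exact hPL x hx

theorem isRealForm_of_span {L : LieSubalgebra ℂ M4} {P : LieSubalgebra ℝ M4}
    (hP : IsTotallyReal P) (hPL : ∀ x ∈ P, x ∈ L) {s : Set M4} (hs : s ⊆ P)
    (hL : L.toSubmodule = Submodule.span ℂ s) : IsRealForm L P := by
  refine ⟨hPL, fun x hx => ?_⟩
  have hx' : x ∈ Submodule.span ℂ s := hL ▸ hx
  obtain ⟨u, hu, v, hv, rfl⟩ := exists_add_I_smul_of_mem_span hx'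
  refine ⟨(u, v), ⟨span_real_le hs hu, span_real_le hs hv, rfl⟩, ?_⟩
  rintro ⟨u', v'⟩ ⟨hu', hv', h⟩
  obtain ⟨rfl, rfl⟩ := hP.eq_and_eq (span_real_le hs hu) (span_real_le hs hv) hu' hv' h
  rfl

/-! ### Descent of gradings and of rigidity from `sl(4, ℂ)` to a real form -/

section RealPart

variable {ι : Type} {Γ : ι → Submodule ℂ M4} {P : LieSubalgebra ℝ M4}

theorem IsFrame.realPart {n : Type} {b : n → M4} {κ : n → ι} (h : IsFrame Γ b κ)
    (hP : IsTotallyReal P) (hb : ∀ i, b i ∈ P) : IsFrame (realPart Γ P) b κ := by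
  refine ⟨h.linearIndependent.restrict_scalars' ℝ, fun k => ?_, h.surjective⟩
  have hs : b '' (κ ⁻¹' {k}) ⊆ P := by
    rintro _ ⟨i, -, rfl⟩
    exact hb i
  refine le_antisymm ?_ (Submodule.span_le.2 ?_)
  · rintro x ⟨hx, hxP⟩
    refine hP.mem_span_real hs hxP ?_
    rw [← h.eq_span]
    exact hx
  · rintro _ ⟨i, hi, rfl⟩
    refine ⟨?_, hb i⟩
    rw [SetLike.mem_coe, Submodule.restrictScalars_mem, h.eq_span]
    exact Submodule.subset_span ⟨i, hi, rfl⟩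

theorem IsFrame.span_realPart {n : Type} {b : n → M4} {κ : n → ι} (h : IsFrame Γ b κ)
    (hb : ∀ i, b i ∈ P) (k : ι) :
    Submodule.span ℂ (FineGradings.realPart Γ P k : Set M4) = Γ k := by
  refine le_antisymm (Submodule.span_le.2 fun x hx => hx.1) ?_
  conv_lhs => rw [h.eq_span]
  refine Submodule.span_mono ?_
  rintro _ ⟨i, hi, rfl⟩
  refine ⟨?_, hb i⟩
  rw [Set.mem_preimage, Set.mem_singleton_iff] at hi
  exact hi ▸ h.mem i

theorem IsFrame.isAbelianGroupGrading_realPart {n : Type} {b : n → M4} {κ : n → ι}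
    (h : IsFrame Γ b κ) (hP : IsTotallyReal P) (hb : ∀ i, b i ∈ P) {L : LieSubalgebra ℂ M4}
    (hL : L.toSubmodule = Submodule.span ℂ (Set.range b)) (hPL : ∀ x ∈ P, x ∈ L)
    (hΓ : IsAbelianGroupGrading L Γ) :
    IsAbelianGroupGrading P (FineGradings.realPart Γ P) := by
  have h' := h.realPart hP hb
  obtain ⟨hg, G, _, d, dinj, hd⟩ := hΓ
  refine ⟨⟨h'.ne_bot, h'.iSupIndep, ?_, fun k l => ?_⟩, G, ‹_›, d, dinj, ?_⟩
  · rw [h'.iSup_eq, span_real_eq hP hPL (Set.range_subset_iff.2 hb) hL]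
  · obtain ⟨m, hm⟩ := hg.bracket k l
    exact ⟨m, fun x hx y hy => ⟨hm x hx.1 y hy.1, P.lie_mem hx.2 hy.2⟩⟩
  · rintro k l ⟨x, hx, y, hy, hxy⟩
    obtain ⟨m, hm, hmb⟩ := hd k l ⟨x, hx.1, y, hy.1, hxy⟩
    exact ⟨m, hm, fun x hx y hy => ⟨hmb x hx.1 y hy.1, P.lie_mem hx.2 hy.2⟩⟩

/-- One vector generates both the complex line and its real part, which is what lets moves of lines
descend. -/
theorem IsLine.realPart (hP : IsTotallyReal P) {k : ι} (hk : IsLine (Γ k))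
    (hspan : Submodule.span ℂ (FineGradings.realPart Γ P k : Set M4) = Γ k) :
    ∃ x, x ≠ 0 ∧ Γ k = Submodule.span ℂ {x} ∧
      FineGradings.realPart Γ P k = Submodule.span ℝ {x} := by
  obtain ⟨y, hy, hky⟩ := hk
  have hne : FineGradings.realPart Γ P k ≠ ⊥ := by
    intro hb
    rw [hb, Submodule.bot_coe, Submodule.span_zero_singleton, hky] at hspan
    exact hy (Submodule.span_singleton_eq_bot.1 hspan.symm)
  obtain ⟨x, hx, hx0⟩ := Submodule.exists_mem_ne_zero_of_ne_bot hne
  have hkx : Γ k = Submodule.span ℂ {x} := by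
    refine (IsLine.eq_of_le ⟨y, hy, hky⟩ ?_ ?_).symm
    · simpa using hx0
    · exact (Submodule.span_singleton_le_iff_mem _ _).2 hx.1
  refine ⟨x, hx0, hkx, le_antisymm (fun z hz => ?_) ?_⟩
  · exact hP.mem_span_real (by simpa using hx.2) hz.2 (hkx ▸ hz.1)
  · exact (Submodule.span_singleton_le_iff_mem _ _).2 hx

/-- The complex witness is a multiple `c • x` of a generator `x` in `P`; dividing by `c` gives a
witness in `P`. -/
theorem Moves.realPart (hP : IsTotallyReal P)
    (hspan : ∀ k, Submodule.span ℂ (FineGradings.realPart Γ P k : Set M4) = Γ k) {u : M4}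
    (hu : u ∈ P) {l m : ι} (h : Moves Γ u l m) : Moves (FineGradings.realPart Γ P) u l m := by
  obtain ⟨hl, hm, y, hy, h0, hym⟩ := h
  obtain ⟨x, hx0, hlx, hlx'⟩ := hl.realPart hP (hspan l)
  obtain ⟨z, hz0, -, hmz'⟩ := hm.realPart hP (hspan m)
  rw [hlx] at hy
  obtain ⟨c, rfl⟩ := Submodule.mem_span_singleton.1 hy
  have hc : c ≠ 0 := by rintro rfl; simp at h0
  have hxl : x ∈ FineGradings.realPart Γ P l := hlx' ▸ Submodule.mem_span_singleton_self x
  rw [lie_smul] at h0 hym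
  refine ⟨⟨x, hx0, hlx'⟩, ⟨z, hz0, hmz'⟩, x, hxl, right_ne_zero_of_smul h0, ?_,
    P.lie_mem hu hxl.2⟩
  simpa [smul_smul, hc] using (Γ m).smul_mem c⁻¹ hym

theorem IsUnsplittable.realPart (hP : IsTotallyReal P)
    (hspan : ∀ k, Submodule.span ℂ (FineGradings.realPart Γ P k : Set M4) = Γ k) {k : ι}
    (h : IsUnsplittable Γ k) : IsUnsplittable (FineGradings.realPart Γ P) k := by
  rcases h with h | h
  · obtain ⟨x, hx0, -, hx⟩ := h.realPart hP (hspan k)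
    exact Or.inl ⟨x, hx0, hx⟩
  · refine Or.inr fun u hu v hv hu0 hv0 => ?_
    obtain ⟨l, m, l', m', h₁, h₂, h₃⟩ := h u hu.1 v hv.1 hu0 hv0
    exact ⟨l, m, l', m', h₁.realPart hP hspan hu.2, h₂.realPart hP hspan hv.2, h₃⟩

end RealPart

/-! ### The displayed subalgebras -/

/-- The complex data of a grading that displays `o_K(4, ℂ)`. -/
structure IsDisplayFrame {ι n : Type} (Γ : ι → Submodule ℂ M4) (S : Set ι) (K : M4) (b : n → M4)
    (κ : n → ι) : Prop where
  frame : IsFrame Γ b κ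
  span_range : Submodule.span ℂ (Set.range b) = sl4.toSubmodule
  grading : IsAbelianGroupGrading sl4 Γ
  unsplittable : ∀ k, IsUnsplittable Γ k
  -- This does not follow from the preceding field: the lines that witness rigidity must now have
  -- index in `S`.
  unsplittable_restrict : ∀ k : S, IsUnsplittable (fun k : S => Γ k) k
  nonempty : S.Nonempty
  symm : Kᵀ = K
  sq : K * K = 1
  skew : ∀ i, κ i ∈ S → b i * K = -(K * (b i)ᵀ)
  self : ∀ i, κ i ∉ S → b i * K = K * (b i)ᵀ

theorem trace_eq_zero_of_mem_oAlg {K : M4} (hK : K * K = 1) {X : M4} (hX : X ∈ oAlg K) :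
    X.trace = 0 := by
  have h : X * K = -(K * Xᵀ) := hX
  have h₁ : X = -(K * Xᵀ * K) := by
    rw [← neg_mul, ← h, Matrix.mul_assoc, hK, Matrix.mul_one]
  have h₂ : X.trace = -X.trace := by
    conv_lhs => rw [h₁, trace_neg, trace_mul_comm, ← Matrix.mul_assoc, hK, Matrix.one_mul,
      trace_transpose]
  exact self_eq_neg.1 h₂

/-- Split an element of `o_K` into its parts along `S` and along the complement. The second part is
both skew and self-adjoint for `K`, hence zero. -/
theorem IsDisplayFrame.oAlg_eq_span {ι n : Type} {Γ : ι → Submodule ℂ M4} {S : Set ι} {K : M4}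
    {b : n → M4} {κ : n → ι} (h : IsDisplayFrame Γ S K b κ) :
    (oAlg K).toSubmodule = Submodule.span ℂ (b '' (κ ⁻¹' S)) := by
  have hle : Submodule.span ℂ (b '' (κ ⁻¹' S)) ≤ (oAlg K).toSubmodule := by
    refine Submodule.span_le.2 ?_
    rintro _ ⟨i, hi, rfl⟩
    exact h.skew i hi
  refine le_antisymm (fun X hX => ?_) hle
  have hX' : X ∈ Submodule.span ℂ (b '' (κ ⁻¹' S)) ⊔ Submodule.span ℂ (b '' (κ ⁻¹' Sᶜ)) := by
    rw [← Submodule.span_union, ← Set.image_union, ← Set.preimage_union, Set.union_compl_self,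
      Set.preimage_univ, Set.image_univ, h.span_range]
    exact (LinearMap.mem_ker (f := Matrix.traceLinearMap (Fin 4) ℂ ℂ)).2
      (trace_eq_zero_of_mem_oAlg h.sq hX)
  have hself : ∀ Z ∈ Submodule.span ℂ (b '' (κ ⁻¹' Sᶜ)), Z * K = K * Zᵀ := by
    intro Z hZ
    induction hZ using Submodule.span_induction with
    | mem Z hZ =>
      obtain ⟨i, hi, rfl⟩ := hZ
      exact h.self i hi
    | zero => simp
    | add x y _ _ hx hy => rw [add_mul, hx, hy, transpose_add, mul_add]
    | smul c x _ hx => rw [smul_mul_assoc, hx, transpose_smul, mul_smul_comm]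
  obtain ⟨Y, hY, Z, hZ, rfl⟩ := Submodule.mem_sup.1 hX'
  have hZo : Z ∈ oAlg K := by
    have := sub_mem hX (hle hY)
    rwa [add_sub_cancel_left] at this
  have hZ0 : Z = 0 := by
    have h₁ : Z * K = -(K * Zᵀ) := hZo
    rw [← hself Z hZ] at h₁
    replace h₁ : Z * K = 0 := Matrix.ext fun i j => self_eq_neg.1 (congrFun (congrFun h₁ i) j)
    rw [← Matrix.mul_one Z, ← h.sq, ← Matrix.mul_assoc, h₁, Matrix.zero_mul]
  rwa [hZ0, add_zero]

theorem IsDisplayFrame.displays {ι n : Type} {Γ : ι → Submodule ℂ M4} {S : Set ι} {K : M4}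
    {b : n → M4} {κ : n → ι} (h : IsDisplayFrame Γ S K b κ) {P : LieSubalgebra ℝ M4}
    (hP : IsTotallyReal P) (htr : ∀ x ∈ P, x.trace = 0) {c : n → ℂ} (hc : ∀ i, c i ≠ 0)
    (hb : ∀ i, c i • b i ∈ P) {R : Type} [LieRing R] [LieAlgebra ℝ R]
    (hR : Nonempty (oInter K P ≃ₗ⁅ℝ⁆ R)) : Displays Γ S K P R := by
  have hf := h.frame.smul hc
  have hsl : ∀ x ∈ P, x ∈ sl4 := fun x hx =>
    (LinearMap.mem_ker (f := Matrix.traceLinearMap (Fin 4) ℂ ℂ)).2 (htr x hx)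
  have hspan : sl4.toSubmodule = Submodule.span ℂ (Set.range fun i => c i • b i) := by
    rw [← hf.iSup_eq, h.frame.iSup_eq, h.span_range]
  have ho : (oAlg K).toSubmodule = ⨆ k : S, Γ k := by
    rw [h.oAlg_eq_span, h.frame.iSup_subtype]
  have hos : (oAlg K).toSubmodule = Submodule.span ℂ ((fun i => c i • b i) '' (κ ⁻¹' S)) := by
    rw [ho, hf.iSup_subtype]
  have hPo : IsTotallyReal (oInter K P) := fun x hx hx' => hP x hx.2 hx'.2
  have hoL : ∀ x ∈ oInter K P, x ∈ oAlg K := fun x hx => hx.1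
  have hs : (fun i => c i • b i) '' (κ ⁻¹' S) ⊆ oInter K P := by
    rintro _ ⟨i, hi, rfl⟩
    exact ⟨(oAlg K).smul_mem _ (h.skew i hi), hb i⟩
  have hre := hf.span_realPart hb
  have hgr := hf.isAbelianGroupGrading_realPart hP hb hspan hsl h.grading
  have hdis : (oInter K P).toSubmodule = ⨆ k : S, realPart Γ P k := by
    rw [span_real_eq hPo hoL hs hos, (hf.realPart hP hb).iSup_subtype]
  refine ⟨⟨isFineGroupGrading_of_isUnsplittable h.grading h.unsplittable,
    isRealForm_of_span hP hsl (Set.range_subset_iff.2 hb) hspan, hre,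
    isFineGroupGrading_of_isUnsplittable hgr fun k => (h.unsplittable k).realPart hP hre⟩,
    h.symm, ?_, isRealForm_of_span hPo hoL hs hos, hR, ho, hdis,
    isFineGroupGrading_of_isUnsplittable (hgr.restrict h.nonempty hdis) fun k =>
      IsUnsplittable.realPart (Γ := fun k : S => Γ k) hP (fun k => hre k)
        (h.unsplittable_restrict k)⟩
  intro hdet
  have := congrArg Matrix.det h.sq
  simp [hdet] at this

/-! ### Matrices of Gaussian integers -/

/-- `4 × 4` matrices of Gaussian integers. -/
abbrev GMat : Type := Matrix (Fin 4) (Fin 4) GaussianInt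

/-- The complex matrix given by a matrix of Gaussian integers. -/
def toM {m n : Type} (X : Matrix m n GaussianInt) : Matrix m n ℂ := X.map GaussianInt.toComplex

section toM

variable {l m n : Type}

theorem toM_add (X Y : Matrix m n GaussianInt) : toM (X + Y) = toM X + toM Y :=
  Matrix.map_add _ (map_add _) _ _

theorem toM_sub (X Y : Matrix m n GaussianInt) : toM (X - Y) = toM X - toM Y :=
  Matrix.map_sub _ (map_sub _) _ _

theorem toM_neg (X : Matrix m n GaussianInt) : toM (-X) = -toM X := by
  ext i j
  exact map_neg GaussianInt.toComplex _

theorem toM_smul (c : GaussianInt) (X : Matrix m n GaussianInt) :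
    toM (c • X) = (c : ℂ) • toM X := by
  ext i j
  exact map_mul GaussianInt.toComplex _ _

theorem toM_mul [Fintype m] (X : Matrix l m GaussianInt) (Y : Matrix m n GaussianInt) :
    toM (X * Y) = toM X * toM Y := Matrix.map_mul

theorem toM_one [DecidableEq n] : toM (1 : Matrix n n GaussianInt) = 1 :=
  Matrix.map_one _ (map_zero _) (map_one _)

theorem toM_transpose (X : Matrix m n GaussianInt) : toM Xᵀ = (toM X)ᵀ := rfl

theorem toM_star (X : Matrix m n GaussianInt) :
    toM (X.map star) = (toM X).map (starRingEnd ℂ) := by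
  ext i j
  exact GaussianInt.toComplex_star _

theorem toM_conjTranspose (X : Matrix m n GaussianInt) : toM Xᴴ = (toM X)ᴴ := by
  ext i j
  exact GaussianInt.toComplex_star _

theorem toM_trace [Fintype n] (X : Matrix n n GaussianInt) :
    (toM X).trace = (X.trace : GaussianInt) := (map_sum GaussianInt.toComplex _ _).symm

theorem toM_lie (X Y : GMat) : ⁅toM X, toM Y⁆ = toM (X * Y - Y * X) := by
  rw [toM_sub, toM_mul, toM_mul, Ring.lie_def]

end toM

/-- The matrix unit `E_{jk}`, with `j, k ∈ {1, 2, 3, 4}`. -/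
def gE (j k : ℕ) : GMat := Matrix.of fun a b => if a.val + 1 = j ∧ b.val + 1 = k then 1 else 0

theorem toM_gE (j k : ℕ) : toM (gE j k) = e j k := by
  ext a b
  simp only [toM, gE, e, Matrix.map_apply, Matrix.of_apply]
  split_ifs
  · exact map_one _
  · exact map_zero _

/-- `b` consists of nonzero traceless matrices that are orthogonal for `tr (X Yᵀ)`. -/
def IsOrthogonalFamily (b : Fin 15 → GMat) : Prop :=
  ∀ i, (b i).trace = 0 ∧ ∀ j, (b i * (b j)ᵀ).trace = 0 ↔ i ≠ j

/-- Pairing a relation with `b j` isolates its `j`-th coefficient. The form is bilinear, not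
hermitian, so `tr (b j (b j)ᵀ) ≠ 0` is a genuine part of the hypothesis. -/
theorem IsOrthogonalFamily.linearIndependent {b : Fin 15 → GMat} (h : IsOrthogonalFamily b) :
    LinearIndependent ℂ fun i => toM (b i) := by
  rw [Fintype.linearIndependent_iff]
  intro c hc j
  have h₁ : ((∑ i, c i • toM (b i)) * (toM (b j))ᵀ).trace = 0 := by simp [hc]
  simp only [Finset.sum_mul, trace_sum, smul_mul_assoc, trace_smul, ← toM_transpose, ← toM_mul,
    toM_trace, smul_eq_mul] at h₁
  rw [Finset.sum_eq_single j] at h₁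
  · refine (mul_eq_zero.1 h₁).resolve_right fun h₀ => ?_
    exact ((h j).2 j).1 (GaussianInt.toComplex_eq_zero.1 h₀) rfl
  · intro i _ hij
    rw [((h i).2 j).2 hij, GaussianInt.toComplex_zero, mul_zero]
  · simp

theorem finrank_sl4 : Module.finrank ℂ sl4.toSubmodule = 15 := by
  have h := (Matrix.traceLinearMap (Fin 4) ℂ ℂ).finrank_range_add_finrank_ker
  have hr : LinearMap.range (Matrix.traceLinearMap (Fin 4) ℂ ℂ) = ⊤ := by
    rw [LinearMap.range_eq_top]
    intro c
    exact ⟨Matrix.single 0 0 c, by simp⟩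
  rw [hr, finrank_top, Module.finrank_self, Module.finrank_matrix] at h
  simp only [Fintype.card_fin, Module.finrank_self, Nat.reduceMul] at h
  have : sl4.toSubmodule = LinearMap.ker (Matrix.traceLinearMap (Fin 4) ℂ ℂ) := rfl
  rw [this]
  exact Nat.add_left_cancel (n := 1) h

theorem IsOrthogonalFamily.span_range {b : Fin 15 → GMat} (h : IsOrthogonalFamily b) :
    Submodule.span ℂ (Set.range fun i => toM (b i)) = sl4.toSubmodule := by
  refine Submodule.eq_of_le_of_finrank_eq (Submodule.span_le.2 ?_) ?_
  · rintro _ ⟨i, rfl⟩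
    refine (LinearMap.mem_ker (f := Matrix.traceLinearMap (Fin 4) ℂ ℂ)).2 ?_
    rw [Matrix.traceLinearMap_apply, toM_trace, (h i).1, GaussianInt.toComplex_zero]
  · rw [finrank_span_eq_card h.linearIndependent, finrank_sl4, Fintype.card_fin]

/-! ### Automorphisms -/

/-- `X ↦ A X A⁻¹`. -/
def conjHom (A A' : M4) (h : A' * A = 1) : M4 →ₗ⁅ℂ⁆ M4 where
  toFun X := A * X * A'
  map_add' X Y := by rw [mul_add, add_mul]
  map_smul' c X := by rw [mul_smul_comm, smul_mul_assoc, RingHom.id_apply]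
  map_lie' {X Y} := by
    have key : ∀ X Y : M4, A * (X * Y) * A' = A * X * A' * (A * Y * A') := fun X Y => by
      calc A * (X * Y) * A' = A * X * 1 * Y * A' := by
            simp only [Matrix.mul_assoc, Matrix.one_mul]
        _ = A * X * A' * (A * Y * A') := by rw [← h]; simp only [Matrix.mul_assoc]
    simp only [Ring.lie_def, mul_sub, sub_mul, key]

/-- `X ↦ -Xᵀ`. -/
def negTransposeHom : M4 →ₗ⁅ℂ⁆ M4 where
  toFun X := -Xᵀ
  map_add' X Y := by rw [transpose_add, neg_add]
  map_smul' c X := by rw [transpose_smul, RingHom.id_apply, smul_neg]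
  map_lie' {X Y} := by
    simp only [Ring.lie_def, transpose_sub, transpose_mul, neg_mul_neg, neg_sub]

/-- Data for one of the automorphisms `X ↦ q⁻¹ A X A'` and `X ↦ -q⁻¹ A Xᵀ A'`. -/
structure AutData where
  /-- the left factor -/
  A : GMat
  /-- the right factor -/
  A' : GMat
  /-- the normalization -/
  q : GaussianInt
  /-- whether the transposition occurs -/
  outer : Bool

/-- The automorphism multiplied by `q`. -/
def AutData.app (f : AutData) (X : GMat) : GMat :=
  f.A * (if f.outer then -Xᵀ else X) * f.A'

/-- The product of the factors is the normalization. -/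
def AutData.IsNormalized (f : AutData) : Prop := f.q ≠ 0 ∧ f.A' * f.A = f.q • (1 : GMat)

/-- The denominator `q` keeps the data in the Gaussian integers when the inverse of `A` is not
integral; over `ℂ` it is divided out. -/
theorem AutData.exists_hom {f : AutData} (hf : f.IsNormalized) :
    ∃ φ : M4 →ₗ⁅ℂ⁆ M4, ∀ X, φ (toM X) = (f.q : ℂ)⁻¹ • toM (f.app X) := by
  have hq : (f.q : ℂ) ≠ 0 := fun h => hf.1 (GaussianInt.toComplex_eq_zero.1 h)
  have h₁ : ((f.q : ℂ)⁻¹ • toM f.A') * toM f.A = 1 := by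
    rw [smul_mul_assoc, ← toM_mul, hf.2, toM_smul, toM_one, smul_smul, inv_mul_cancel₀ hq, one_smul]
  rcases ho : f.outer with _ | _
  · refine ⟨conjHom _ _ h₁, fun X => ?_⟩
    change toM f.A * toM X * ((f.q : ℂ)⁻¹ • toM f.A') = _
    simp [AutData.app, ho, toM_mul]
  · refine ⟨(conjHom _ _ h₁).comp negTransposeHom, fun X => ?_⟩
    change toM f.A * (-(toM X)ᵀ) * ((f.q : ℂ)⁻¹ • toM f.A') = _
    simp [AutData.app, ho, toM_mul, toM_neg, toM_transpose]

theorem isAbelianGroupGrading_of_autData {ι : Type} {Γ : ι → Submodule ℂ M4} {b : Fin 15 → GMat}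
    {κ : Fin 15 → ι} (hb : IsOrthogonalFamily b) (hf : IsFrame Γ (fun i => toM (b i)) κ) {r : ℕ}
    (f : Fin r → AutData) (hfn : ∀ s, (f s).IsNormalized) (p : ι → Fin r → GaussianInt)
    (hp : Function.Injective p) (hp0 : ∀ k s, p k s ≠ 0)
    (hfp : ∀ s i, (f s).app (b i) = p (κ i) s • b i) : IsAbelianGroupGrading sl4 Γ := by
  choose φ hφ using fun s => AutData.exists_hom (hfn s)
  have hq : ∀ s, ((f s).q : ℂ) ≠ 0 := fun s h => (hfn s).1 (GaussianInt.toComplex_eq_zero.1 h)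
  have hp' : ∀ k s, (p k s : ℂ) ≠ 0 := fun k s h => hp0 k s (GaussianInt.toComplex_eq_zero.1 h)
  refine hf.isAbelianGroupGrading hb.span_range φ
    (χ := fun k s => Units.mk0 (((f s).q : ℂ)⁻¹ * p k s)
      (mul_ne_zero (inv_ne_zero (hq s)) (hp' k s)))
    ?_ ?_
  · intro k l hkl
    refine hp (funext fun s => ?_)
    have := congrArg Units.val (congrFun hkl s)
    exact GaussianInt.toComplex_inj.1 (mul_left_cancel₀ (inv_ne_zero (hq s)) this)
  · intro s i
    rw [hφ, hfp, toM_smul, smul_smul]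
    rfl

/-! ### Weights of a component on the lines -/

/-- `κ i` labels only the element with index `i`. -/
def IsLineIndex {ι : Type} (κ : Fin 15 → ι) (i : Fin 15) : Prop := ∀ j, κ j = κ i → j = i

theorem isFrame_of_orthogonal {ι : Type} {Γ : ι → Submodule ℂ M4} {b : Fin 15 → GMat}
    {κ : Fin 15 → ι} (hb : IsOrthogonalFamily b) (hκ : Function.Surjective κ) (k₀ : ι)
    (J : Finset (Fin 15)) (hJ : ∀ i, κ i = k₀ ↔ i ∈ J) (hκ' : ∀ i, IsLineIndex κ i ∨ κ i = k₀)
    (hline : ∀ i, κ i ≠ k₀ → Γ (κ i) = Submodule.span ℂ {toM (b i)})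
    (h₀ : Γ k₀ = Submodule.span ℂ ((fun i => toM (b i)) '' J)) :
    IsFrame Γ (fun i => toM (b i)) κ := by
  refine ⟨hb.linearIndependent, fun k => ?_, hκ⟩
  obtain ⟨i, rfl⟩ := hκ k
  by_cases hi : κ i = k₀
  · have : κ ⁻¹' {k₀} = J := by
      ext j
      exact hJ j
    rw [hi, h₀, this]
  · have : κ ⁻¹' {κ i} = {i} := by
      ext j
      exact ⟨(hκ' i).resolve_right hi j, fun h => congrArg κ h⟩
    rw [hline i hi, this, Set.image_singleton]

theorem isFrame_of_line {Γ : Fin 15 → Submodule ℂ M4} {b : Fin 15 → GMat}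
    (hb : IsOrthogonalFamily b) (hline : ∀ i, Γ i = Submodule.span ℂ {toM (b i)}) :
    IsFrame Γ (fun i => toM (b i)) id :=
  -- With lines only, any index can play the exceptional one; `0` is arbitrary.
  isFrame_of_orthogonal hb Function.surjective_id 0 {0} (by simp) (fun _ => Or.inl fun _ h => h)
    (fun i _ => hline i) (by simp [hline])

/-- The elements `b (J a)` span `Γ k`, and `[b (J a), b (l t)] = w t a • b (m t)`, where `b (l t)`
and `b (m t)` span lines. -/
structure HasWeights {ι : Type} (b : Fin 15 → GMat) (κ : Fin 15 → ι) (k : ι) {r n : ℕ}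
    (J : Fin r → Fin 15) (l m : Fin n → Fin 15) (w : Fin n → Fin r → ℤ) : Prop where
  mem_iff : ∀ i, κ i = k ↔ ∃ a, J a = i
  line_left : ∀ t, IsLineIndex κ (l t)
  line_right : ∀ t, IsLineIndex κ (m t)
  lie_eq : ∀ a t, b (J a) * b (l t) - b (l t) * b (J a) = (w t a : GaussianInt) • b (m t)

/-- With `α` the coordinates of `u`, each row of `w` is a linear form in `α`, and its value is the
factor by which `u` takes `b (l t)` to `b (m t)`. -/
theorem HasWeights.exists_moves {ι : Type} {Γ : ι → Submodule ℂ M4} {b : Fin 15 → GMat}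
    {κ : Fin 15 → ι} {k : ι} {r n : ℕ} {J : Fin r → Fin 15} {l m : Fin n → Fin 15}
    {w : Fin n → Fin r → ℤ} (h : HasWeights b κ k J l m w)
    (hf : IsFrame Γ (fun i => toM (b i)) κ) {u : M4} (hu : u ∈ Γ k) (hu0 : u ≠ 0) :
    ∃ α : Fin r → ℂ, α ≠ 0 ∧ ∀ t, ∑ a, α a * w t a ≠ 0 → Moves Γ u (κ (l t)) (κ (m t)) := by
  have hJ : (fun i => toM (b i)) '' (κ ⁻¹' {k}) = Set.range fun a => toM (b (J a)) := by
    ext x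
    simp only [Set.mem_image, Set.mem_preimage, Set.mem_singleton_iff, h.mem_iff, Set.mem_range]
    constructor
    · rintro ⟨_, ⟨a, rfl⟩, rfl⟩
      exact ⟨a, rfl⟩
    · rintro ⟨a, rfl⟩
      exact ⟨J a, ⟨a, rfl⟩, rfl⟩
  rw [hf.eq_span, hJ] at hu
  obtain ⟨α, rfl⟩ := (Submodule.mem_span_range_iff_exists_fun ℂ).1 hu
  refine ⟨α, ?_, fun t ht => ⟨hf.isLine (h.line_left t), hf.isLine (h.line_right t), _,
    hf.mem (l t), ?_⟩⟩
  · rintro rfl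
    simp at hu0
  · have hlie : ⁅∑ a, α a • toM (b (J a)), toM (b (l t))⁆ =
        (∑ a, α a * (w t a : ℂ)) • toM (b (m t)) := by
      rw [sum_lie, Finset.sum_smul]
      refine Finset.sum_congr rfl fun a _ => ?_
      rw [smul_lie, toM_lie, h.lie_eq, toM_smul, smul_smul, map_intCast]
    rw [hlie]
    exact ⟨smul_ne_zero ht (hf.linearIndependent.ne_zero (m t)),
      Submodule.smul_mem _ _ (hf.mem (m t))⟩

/-- Any two nonzero elements have a common nonzero weight. -/
theorem HasWeights.isUnsplittable {ι : Type} {Γ : ι → Submodule ℂ M4} {b : Fin 15 → GMat}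
    {κ : Fin 15 → ι} {k : ι} {r n : ℕ} {J : Fin r → Fin 15} {l m : Fin n → Fin 15}
    {w : Fin n → Fin r → ℤ} (h : HasWeights b κ k J l m w)
    (hf : IsFrame Γ (fun i => toM (b i)) κ)
    (hsep : ∀ α β : Fin r → ℂ, (∀ t, ∑ a, α a * w t a = 0 ∨ ∑ a, β a * w t a = 0) →
      α = 0 ∨ β = 0) : IsUnsplittable Γ k := by
  refine Or.inr fun u hu v hv hu0 hv0 => ?_
  obtain ⟨α, hα, hαm⟩ := h.exists_moves hf hu hu0
  obtain ⟨β, hβ, hβm⟩ := h.exists_moves hf hv hv0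
  by_contra hne
  have ht : ∀ t, ∑ a, α a * w t a = 0 ∨ ∑ a, β a * w t a = 0 := fun t => by
    by_contra! ht
    exact hne ⟨_, _, _, _, hαm t ht.1, hβm t ht.2, Or.inl ⟨rfl, rfl⟩⟩
  exact (hsep α β ht).elim hα hβ

/-! ### Decidable data of a grading -/

/-- The imaginary unit. -/
def gI : GaussianInt := ⟨0, 1⟩

/-- The automorphism given by a unitary matrix. -/
def unitaryAut (A : GMat) (outer : Bool) : AutData := ⟨A, Aᴴ, 1, outer⟩

def gK₂ : GMat := !![1, 0, 0, 0; 0, 1, 0, 0; 0, 0, 0, 1; 0, 0, 1, 0]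

def gK₃ : GMat := !![0, 1, 0, 0; 1, 0, 0, 0; 0, 0, 0, 1; 0, 0, 1, 0]

theorem toM_gK₂ : toM gK₂ = K₂ := by
  ext i j
  fin_cases i <;> fin_cases j <;> simp [toM, gK₂, K₂]

theorem toM_gK₃ : toM gK₃ = K₃ := by
  ext i j
  fin_cases i <;> fin_cases j <;> simp [toM, gK₃, K₃]

instance {n : ℕ} (κ : Fin 15 → Fin n) (i : Fin 15) : Decidable (IsLineIndex κ i) :=
  inferInstanceAs (Decidable (∀ j, κ j = κ i → j = i))

instance (b : Fin 15 → GMat) : Decidable (IsOrthogonalFamily b) :=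
  inferInstanceAs (Decidable (∀ i, (b i).trace = 0 ∧ ∀ j, (b i * (b j)ᵀ).trace = 0 ↔ i ≠ j))

instance (f : AutData) : Decidable f.IsNormalized :=
  inferInstanceAs (Decidable (f.q ≠ 0 ∧ f.A' * f.A = f.q • (1 : GMat)))

/-- The family `b` is an orthogonal basis of `sl(4, ℂ)` that consists of eigenvectors of the
automorphisms `f`, with eigenvalues `p`, and of the involution `X ↦ K Xᵀ K`, with eigenvalue `-1`
exactly on the components with index in `T`. -/
structure IsGradingData {n r : ℕ} (b : Fin 15 → GMat) (κ : Fin 15 → Fin n) (f : Fin r → AutData)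
    (p : Fin r → Fin n → GaussianInt) (K : GMat) (T : Finset (Fin n)) : Prop where
  orthogonal : IsOrthogonalFamily b
  surjective : Function.Surjective κ
  normalized : ∀ s, (f s).IsNormalized
  injective : Function.Injective fun k s => p s k
  ne_zero : ∀ s k, p s k ≠ 0
  app_eq : ∀ s i, (f s).app (b i) = p s (κ i) • b i
  nonempty : T.Nonempty
  symm : Kᵀ = K
  sq : K * K = 1
  mul_eq : ∀ i, b i * K = if κ i ∈ T then -(K * (b i)ᵀ) else K * (b i)ᵀ

theorem isUnsplittable_of_isLineIndex {ι : Type} {Γ : ι → Submodule ℂ M4} {b : Fin 15 → GMat}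
    {κ : Fin 15 → ι} (hf : IsFrame Γ (fun i => toM (b i)) κ) (k₀ : ι)
    (hκ : ∀ i, IsLineIndex κ i ∨ κ i = k₀) (h₀ : IsUnsplittable Γ k₀) (k : ι) :
    IsUnsplittable Γ k := by
  obtain ⟨i, rfl⟩ := hf.surjective k
  rcases hκ i with hi | hi
  · exact Or.inl (hf.isLine hi)
  · exact hi ▸ h₀

/-- This covers all gradings but `Γ₅`, the only one whose thick component belongs to the displayed
subalgebra. -/
theorem isUnsplittable_restrict_of_isLineIndex {n : ℕ} {Γ : Fin n → Submodule ℂ M4}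
    {b : Fin 15 → GMat} {κ : Fin 15 → Fin n} (hf : IsFrame Γ (fun i => toM (b i)) κ)
    (T : Finset (Fin n)) (hT : ∀ i, κ i ∈ T → IsLineIndex κ i) (k : (T : Set (Fin n))) :
    IsUnsplittable (fun k : (T : Set (Fin n)) => Γ k) k := by
  obtain ⟨k, hk⟩ := k
  obtain ⟨i, rfl⟩ := hf.surjective k
  exact Or.inl (hf.isLine (hT i hk))

theorem IsGradingData.isDisplayFrame {n r : ℕ} {b : Fin 15 → GMat} {κ : Fin 15 → Fin n}
    {f : Fin r → AutData} {p : Fin r → Fin n → GaussianInt} {K : GMat} {T : Finset (Fin n)}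
    (h : IsGradingData b κ f p K T) {Γ : Fin n → Submodule ℂ M4}
    (hf : IsFrame Γ (fun i => toM (b i)) κ) (hu : ∀ k, IsUnsplittable Γ k)
    (hT : ∀ k, IsUnsplittable (fun k : (T : Set (Fin n)) => Γ k) k) :
    IsDisplayFrame Γ T (toM K) (fun i => toM (b i)) κ where
  frame := hf
  span_range := h.orthogonal.span_range
  grading := isAbelianGroupGrading_of_autData h.orthogonal hf f h.normalized _ h.injective
    (fun k s => h.ne_zero s k) h.app_eq
  unsplittable := hu
  unsplittable_restrict := hT
  nonempty := h.nonempty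
  symm := by rw [← toM_transpose, h.symm]
  sq := by rw [← toM_mul, h.sq, toM_one]
  skew i hi := by
    rw [← toM_mul, h.mul_eq, if_pos (Finset.mem_coe.1 hi), toM_neg, toM_mul, toM_transpose]
  self i hi := by
    rw [← toM_mul, h.mul_eq, if_neg (mt Finset.mem_coe.2 hi), toM_mul, toM_transpose]

/-! ### The six gradings

For each of them, `b` is a basis of homogeneous elements, `κ` assigns the grading subspaces to them,
and `p` contains the eigenvalues of the automorphisms `aut` on the grading subspaces. -/

/-! ### The grading `Γ₃` -/

def b₃ : Fin 15 → GMat :=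
  ![gE 1 4 + gE 4 1, gE 1 4 - gE 4 1, gE 2 4 + gE 4 2, gE 2 4 - gE 4 2, gE 3 4 + gE 4 3,
    gE 3 4 - gE 4 3, gE 1 3 + gE 3 1, gE 1 3 - gE 3 1, gE 2 3 + gE 3 2, gE 2 3 - gE 3 2,
    gE 1 2 + gE 2 1, gE 1 2 - gE 2 1, gE 1 1 - gE 2 2, gE 3 3 - gE 4 4,
    gE 1 1 + gE 2 2 - gE 3 3 - gE 4 4]

def κ₃ : Fin 15 → Fin 13 := ![0, 1, 2, 3, 4, 5, 6, 7, 8, 9, 10, 11, 12, 12, 12]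

/-- The diagonal signs separate the index pairs `{j, k}`, and `X ↦ -Xᵀ` separates symmetric from
skew matrices. -/
def aut₃ : Fin 4 → AutData :=
  ![unitaryAut 1 true,
    unitaryAut (diagonal ![1, 1, 1, -1]) false,
    unitaryAut (diagonal ![1, 1, -1, 1]) false,
    unitaryAut (diagonal ![1, -1, 1, 1]) false]

def p₃ : Fin 4 → Fin 13 → GaussianInt :=
  ![![-1, 1, -1, 1, -1, 1, -1, 1, -1, 1, -1, 1, -1],
    ![-1, -1, -1, -1, -1, -1, 1, 1, 1, 1, 1, 1, 1],
    ![1, 1, 1, 1, -1, -1, -1, -1, -1, -1, 1, 1, 1],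
    ![1, 1, -1, -1, 1, 1, 1, 1, -1, -1, -1, -1, 1]]

theorem isGradingData₃ : IsGradingData b₃ κ₃ aut₃ p₃ 1 {1, 3, 5, 7, 9, 11} := by
  constructor <;> decide +kernel

theorem isFrame₃ : IsFrame Γ₃ (fun i => toM (b₃ i)) κ₃ := by
  refine isFrame_of_orthogonal isGradingData₃.orthogonal isGradingData₃.surjective 12 {12, 13, 14}
    (by decide) (by decide) (fun i hi => ?_) ?_
  · fin_cases i
    iterate 12 simp [Γ₃, κ₃, b₃, toM_add, toM_sub, toM_gE]
    all_goals exact absurd rfl hi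
  -- The defining generators of the diagonal part are not orthogonal, so `b₃` uses another basis of
  -- it; the coefficients below convert between the two.
  · have h : Γ₃ 12 = sp {e 1 1 - e 2 2, e 2 2 - e 3 3, e 3 3 - e 4 4} := rfl
    simp only [h, Finset.coe_insert, Finset.coe_singleton, Set.image_insert_eq,
      Set.image_singleton, b₃, toM_add, toM_sub, toM_gE, Matrix.cons_val]
    refine le_antisymm (Submodule.span_le.2 ?_) (Submodule.span_le.2 ?_)
    · rintro _ (rfl | rfl | rfl)
      · exact Submodule.mem_span_of_mem (by simp)
      · rw [SetLike.mem_coe, Submodule.mem_span_triple]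
        exact ⟨-1 / 2, -1 / 2, 1 / 2, by module⟩
      · exact Submodule.mem_span_of_mem (by simp)
    · rintro _ (rfl | rfl | rfl)
      · exact Submodule.mem_span_of_mem (by simp)
      · exact Submodule.mem_span_of_mem (by simp)
      · rw [SetLike.mem_coe, Submodule.mem_span_triple]
        exact ⟨1, 2, 1, by module⟩

/-- A diagonal matrix `D` takes `E_jk + E_kj` to `(D_j - D_k)(E_jk - E_kj)`. -/
theorem hasWeights₃ : HasWeights b₃ κ₃ 12 ![12, 13, 14] ![0, 2, 4, 6, 8, 10] ![1, 3, 5, 7, 9, 11]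
    ![![1, 1, 2], ![-1, 1, 2], ![0, 2, 0], ![1, -1, 2], ![-1, -1, 2], ![2, 0, 0]] := by
  constructor <;> decide +kernel

theorem isDisplayFrame₃ : IsDisplayFrame Γ₃ S₃ K₁ (fun i => toM (b₃ i)) κ₃ := by
  have hu : IsUnsplittable Γ₃ 12 := by
    refine hasWeights₃.isUnsplittable isFrame₃ fun α β h => ?_
    simp [Fin.forall_fin_succ, Fin.sum_univ_three] at h
    obtain ⟨h0, h1, h2, h3, h4, h5⟩ := h
    -- For each pair `j < k`, the `j`-th and `k`-th diagonal entries agree for `α` or for `β`. Two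
    -- equivalence relations whose union is everything include the full relation, so one of the two
    -- traceless diagonal matrices is scalar, hence zero.
    have : (α 0 = 0 ∧ α 1 = 0 ∧ α 2 = 0) ∨ (β 0 = 0 ∧ β 1 = 0 ∧ β 2 = 0) := by grind
    simpa [funext_iff, Fin.forall_fin_succ] using this
  have h := isGradingData₃.isDisplayFrame isFrame₃
    (isUnsplittable_of_isLineIndex isFrame₃ 12 (by decide) hu)
    (isUnsplittable_restrict_of_isLineIndex isFrame₃ _ (by decide))
  rw [toM_one] at h
  simpa [S₃, K₁] using h


/-! ### The grading `Γ₄` -/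

def b₄ : Fin 15 → GMat :=
  ![gE 1 3 - gE 4 1, gE 1 3 + gE 4 1, gE 1 4 - gE 3 1, gE 1 4 + gE 3 1, gE 2 4 - gE 3 2,
    gE 2 4 + gE 3 2, gE 2 3 - gE 4 2, gE 2 3 + gE 4 2, gE 1 2 - gE 2 1, gE 1 2 + gE 2 1, gE 3 4,
    gE 4 3, gE 3 3 - gE 4 4, gE 1 1 - gE 2 2, gE 1 1 + gE 2 2 - gE 3 3 - gE 4 4]

def κ₄ : Fin 15 → Fin 14 := ![0, 1, 2, 3, 4, 5, 6, 7, 8, 9, 10, 11, 12, 13, 13]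

/-- The first factor is `2 diag(1, 1, z, z⁻¹)` at `z = 2`, with eigenvalues `1`, `z^{±1}`, `z^{±2}`
once `q = 4` is divided out. -/
def aut₄ : Fin 3 → AutData :=
  ![⟨diagonal ![2, 2, 4, 1], diagonal ![2, 2, 1, 4], 4, false⟩,
    unitaryAut gK₂ true,
    unitaryAut (diagonal ![1, -1, 1, 1]) false]

def p₄ : Fin 3 → Fin 14 → GaussianInt :=
  ![![2, 2, 8, 8, 8, 8, 2, 2, 4, 4, 16, 1, 4, 4],
    ![1, -1, 1, -1, 1, -1, 1, -1, 1, -1, -1, -1, 1, -1],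
    ![1, 1, 1, 1, -1, -1, -1, -1, -1, -1, 1, 1, 1, 1]]

theorem isGradingData₄ : IsGradingData b₄ κ₄ aut₄ p₄ gK₂ {12, 0, 4, 8, 6, 2} := by
  constructor <;> decide +kernel

theorem isFrame₄ : IsFrame Γ₄ (fun i => toM (b₄ i)) κ₄ := by
  refine isFrame_of_orthogonal isGradingData₄.orthogonal isGradingData₄.surjective 13 {13, 14}
    (by decide) (by decide) (fun i hi => ?_) ?_
  · fin_cases i
    iterate 13 simp [Γ₄, κ₄, b₄, toM_add, toM_sub, toM_gE]
    all_goals exact absurd rfl hi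
  · simp [Γ₄, b₄, Set.image_insert_eq, toM_add, toM_sub, toM_gE]

theorem hasWeights₄ : HasWeights b₄ κ₄ 13 ![13, 14] ![0, 4, 8] ![1, 5, 9]
    ![![1, 2], ![-1, 2], ![2, 0]] := by
  constructor <;> decide +kernel

theorem isDisplayFrame₄ : IsDisplayFrame Γ₄ S₄ K₂ (fun i => toM (b₄ i)) κ₄ := by
  have hu : IsUnsplittable Γ₄ 13 := by
    refine hasWeights₄.isUnsplittable isFrame₄ fun α β h => ?_
    simp [Fin.forall_fin_succ, Fin.sum_univ_two] at h
    -- Of three pairwise independent forms on a plane, two vanish at the same vector, which is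
    -- therefore zero.
    have : (α 0 = 0 ∧ α 1 = 0) ∨ (β 0 = 0 ∧ β 1 = 0) := by grind
    simpa [funext_iff, Fin.forall_fin_succ] using this
  have h := isGradingData₄.isDisplayFrame isFrame₄
    (isUnsplittable_of_isLineIndex isFrame₄ 13 (by decide) hu)
    (isUnsplittable_restrict_of_isLineIndex isFrame₄ _ (by decide))
  rw [toM_gK₂] at h
  simpa [S₄] using h

/-! ### The grading `Γ₅` -/

def b₅ : Fin 15 → GMat :=
  ![gE 2 3 - gE 4 1, gE 2 3 + gE 4 1, gE 2 4 - gE 3 1, gE 2 4 + gE 3 1, gE 1 3 - gE 4 2,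
    gE 1 3 + gE 4 2, gE 1 4 - gE 3 2, gE 1 4 + gE 3 2, gE 1 2, gE 2 1, gE 3 4, gE 4 3,
    gE 1 1 + gE 2 2 - gE 3 3 - gE 4 4, gE 1 1 - gE 2 2 + gE 3 3 - gE 4 4,
    gE 1 1 - gE 2 2 - gE 3 3 + gE 4 4]

def κ₅ : Fin 15 → Fin 14 := ![0, 1, 2, 3, 4, 5, 6, 7, 8, 9, 10, 11, 12, 13, 13]

/-- Two automorphisms of order four, one inner and one outer, separate the 14 components. -/
def aut₅ : Fin 2 → AutData :=
  ![unitaryAut (diagonal ![1, 1, gI, -gI]) false,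
    unitaryAut !![0, 1, 0, 0; gI, 0, 0, 0; 0, 0, 0, 1; 0, 0, gI, 0] true]

def p₅ : Fin 2 → Fin 14 → GaussianInt :=
  ![![-gI, -gI, gI, gI, -gI, -gI, gI, gI, 1, 1, -1, -1, 1, 1],
    ![gI, -gI, 1, -1, 1, -1, -gI, gI, gI, -gI, gI, -gI, -1, 1]]

theorem isGradingData₅ : IsGradingData b₅ κ₅ aut₅ p₅ gK₃ {13, 0, 2, 4, 6} := by
  constructor <;> decide +kernel

theorem isFrame₅ : IsFrame Γ₅ (fun i => toM (b₅ i)) κ₅ := by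
  refine isFrame_of_orthogonal isGradingData₅.orthogonal isGradingData₅.surjective 13 {13, 14}
    (by decide) (by decide) (fun i hi => ?_) ?_
  · fin_cases i
    iterate 13 simp [Γ₅, κ₅, b₅, toM_add, toM_sub, toM_gE]
    all_goals exact absurd rfl hi
  · simp [Γ₅, b₅, Set.image_insert_eq, toM_add, toM_sub, toM_gE]

theorem hasWeights₅ : HasWeights b₅ κ₅ 13 ![13, 14] ![0, 2] ![0, 2] ![![-2, 0], ![0, -2]] := by
  constructor <;> decide +kernel

/-- The two-dimensional component of `Γ₅` acts diagonally on `L₁` and `L₃`. -/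
theorem exists_moves₅ {u : M4} (hu : u ∈ Γ₅ 13) (hu0 : u ≠ 0) :
    Moves Γ₅ u 0 0 ∨ Moves Γ₅ u 2 2 := by
  obtain ⟨α, hα, h⟩ := hasWeights₅.exists_moves isFrame₅ hu hu0
  by_cases h0 : α 0 = 0
  · refine Or.inr (h 1 ?_)
    have h1 : α 1 ≠ 0 := fun h1 => hα (by simp [funext_iff, Fin.forall_fin_succ, h0, h1])
    simpa [Fin.sum_univ_two] using h1
  · exact Or.inl (h 0 (by simpa [Fin.sum_univ_two] using h0))

/-- Every nonzero element of the plane acts by a nonzero scalar on `L₁` or `L₃`, so homogeneous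
pieces of the plane have the identity label. Both lines have index in `S₅`, so the argument serves
for `sl(4, ℂ)` and for `o_K` alike. -/
theorem isDisplayFrame₅ : IsDisplayFrame Γ₅ S₅ K₃ (fun i => toM (b₅ i)) κ₅ := by
  have hex : ∀ u ∈ Γ₅ 13, u ≠ 0 →
      ∃ l : (({13, 0, 2, 4, 6} : Finset (Fin 14)) : Set (Fin 14)), Moves Γ₅ u l l := by
    intro u hu hu0
    rcases exists_moves₅ hu hu0 with h | h
    · exact ⟨⟨0, by simp⟩, h⟩
    · exact ⟨⟨2, by simp⟩, h⟩
  have hu : IsUnsplittable Γ₅ 13 := by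
    refine Or.inr fun u hu v hv hu0 hv0 => ?_
    obtain ⟨l, hl⟩ := hex u hu hu0
    obtain ⟨m, hm⟩ := hex v hv hv0
    exact ⟨l, l, m, m, hl, hm, Or.inr ⟨rfl, rfl⟩⟩
  have h := isGradingData₅.isDisplayFrame isFrame₅
    (isUnsplittable_of_isLineIndex isFrame₅ 13 (by decide) hu) ?_
  · rw [toM_gK₃] at h
    simpa [S₅] using h
  · rintro ⟨k, hk⟩
    obtain ⟨i, rfl⟩ := isFrame₅.surjective k
    have hi : IsLineIndex κ₅ i ∨ κ₅ i = 13 := by revert i; decide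
    rcases hi with hi | hi
    · exact Or.inl (isFrame₅.isLine hi)
    · refine Or.inr fun u hu v hv hu0 hv0 => ?_
      obtain ⟨l, hl⟩ := hex u (hi ▸ hu) hu0
      obtain ⟨m, hm⟩ := hex v (hi ▸ hv) hv0
      exact ⟨l, l, m, m, hl, hm, Or.inr ⟨rfl, rfl⟩⟩

/-! ### The grading `Γ₆` -/

def b₆ : Fin 15 → GMat :=
  ![gE 1 1 - gE 2 2 + gE 3 3 - gE 4 4, gE 1 1 - gE 2 2 - gE 3 3 + gE 4 4,
    gE 1 1 + gE 2 2 - gE 3 3 - gE 4 4, gE 1 3 - gE 2 4 + gE 3 1 - gE 4 2,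
    gE 1 3 + gE 2 4 - gE 3 1 - gE 4 2, gE 1 3 + gE 2 4 + gE 3 1 + gE 4 2,
    gE 1 3 - gE 2 4 - gE 3 1 + gE 4 2, gE 2 1 + gE 4 3, gE 2 1 - gE 4 3, gE 1 4 - gE 3 2,
    gE 1 4 + gE 3 2, gE 2 3 - gE 4 1, gE 2 3 + gE 4 1, gE 1 2 + gE 3 4, gE 1 2 - gE 3 4]

def aut₆ : Fin 3 → AutData :=
  ![unitaryAut (diagonal ![1, 1, -1, -1]) false,
    unitaryAut !![0, 1, 0, 0; gI, 0, 0, 0; 0, 0, 0, 1; 0, 0, gI, 0] true,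
    unitaryAut !![0, 0, 1, 0; 0, 0, 0, 1; 1, 0, 0, 0; 0, 1, 0, 0] false]

def p₆ : Fin 3 → Fin 15 → GaussianInt :=
  ![![1, 1, 1, -1, -1, -1, -1, 1, 1, -1, -1, -1, -1, 1, 1],
    ![1, 1, -1, 1, 1, -1, -1, -gI, -gI, -gI, gI, gI, -gI, gI, gI],
    ![1, -1, -1, 1, -1, 1, -1, 1, -1, -1, 1, -1, 1, 1, -1]]

theorem isGradingData₆ : IsGradingData b₆ id aut₆ p₆ gK₃ {0, 1, 9, 3, 4, 11} := by
  constructor <;> decide +kernel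

theorem isFrame₆ : IsFrame Γ₆ (fun i => toM (b₆ i)) id :=
  isFrame_of_line isGradingData₆.orthogonal fun i => by
    fin_cases i <;> simp [Γ₆, b₆, toM_add, toM_sub, toM_gE]

theorem isDisplayFrame₆ : IsDisplayFrame Γ₆ S₆ K₃ (fun i => toM (b₆ i)) id := by
  have h := isGradingData₆.isDisplayFrame isFrame₆
    (fun k => Or.inl (isFrame₆.isLine (i := k) fun _ h => h))
    (isUnsplittable_restrict_of_isLineIndex isFrame₆ _ fun _ _ _ h => h)
  rw [toM_gK₃] at h
  simpa [S₆] using h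

/-! ### The grading `Γ₇` by tensor products of Pauli matrices -/

def b₇ : Fin 15 → GMat :=
  ![gE 1 4 + gE 2 3 + gE 3 2 + gE 4 1, gE 1 4 - gE 2 3 - gE 3 2 + gE 4 1,
    gE 1 4 - gE 2 3 + gE 3 2 - gE 4 1, gE 1 4 + gE 2 3 - gE 3 2 - gE 4 1,
    gE 1 3 + gE 2 4 + gE 3 1 + gE 4 2, gE 1 3 - gE 2 4 - gE 3 1 + gE 4 2,
    gE 1 3 - gE 2 4 + gE 3 1 - gE 4 2, gE 1 3 + gE 2 4 - gE 3 1 - gE 4 2,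
    gE 1 2 + gE 2 1 + gE 3 4 + gE 4 3, gE 1 2 - gE 2 1 - gE 3 4 + gE 4 3,
    gE 1 2 - gE 2 1 + gE 3 4 - gE 4 3, gE 1 2 + gE 2 1 - gE 3 4 - gE 4 3,
    gE 1 1 - gE 2 2 - gE 3 3 + gE 4 4, gE 1 1 - gE 2 2 + gE 3 3 - gE 4 4,
    gE 1 1 + gE 2 2 - gE 3 3 - gE 4 4]

/-- Conjugation by `σ_z ⊗ 1`, `1 ⊗ σ_z`, `1 ⊗ σ_x` and `σ_x ⊗ 1`; the components realize the 15
nontrivial sign patterns. -/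
def aut₇ : Fin 4 → AutData :=
  ![unitaryAut (diagonal ![1, 1, -1, -1]) false,
    unitaryAut (diagonal ![1, -1, 1, -1]) false,
    unitaryAut gK₃ false,
    unitaryAut !![0, 0, 1, 0; 0, 0, 0, 1; 1, 0, 0, 0; 0, 1, 0, 0] false]

def p₇ : Fin 4 → Fin 15 → GaussianInt :=
  ![![-1, -1, -1, -1, -1, -1, -1, -1, 1, 1, 1, 1, 1, 1, 1],
    ![-1, -1, -1, -1, 1, 1, 1, 1, -1, -1, -1, -1, 1, 1, 1],
    ![1, -1, -1, 1, 1, -1, -1, 1, 1, -1, -1, 1, -1, -1, 1],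
    ![1, -1, 1, -1, 1, -1, 1, -1, 1, -1, 1, -1, -1, 1, -1]]

theorem isGradingData₇ : IsGradingData b₇ id aut₇ p₇ 1 {2, 3, 7, 5, 10, 9} := by
  constructor <;> decide +kernel

theorem isFrame₇ : IsFrame Γ₇ (fun i => toM (b₇ i)) id :=
  isFrame_of_line isGradingData₇.orthogonal fun i => by
    fin_cases i <;> simp [Γ₇, b₇, toM_add, toM_sub, toM_gE]

theorem isDisplayFrame₇ : IsDisplayFrame Γ₇ S₇ K₁ (fun i => toM (b₇ i)) id := by
  have h := isGradingData₇.isDisplayFrame isFrame₇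
    (fun k => Or.inl (isFrame₇.isLine (i := k) fun _ h => h))
    (isUnsplittable_restrict_of_isLineIndex isFrame₇ _ fun _ _ _ h => h)
  rw [toM_one] at h
  simpa [S₇, K₁] using h

/-! ### The grading `Γ₈` -/

def b₈ : Fin 15 → GMat :=
  ![gE 1 3 + gE 2 4 + gE 3 2 + gE 4 1, gE 1 3 - gE 2 4 - gE 3 2 + gE 4 1,
    gE 1 3 - gE 2 4 + gE 3 2 - gE 4 1, gE 1 3 + gE 2 4 - gE 3 2 - gE 4 1,
    gE 1 4 + gE 2 3 + gE 3 1 + gE 4 2, gE 1 4 - gE 2 3 - gE 3 1 + gE 4 2,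
    gE 1 4 - gE 2 3 + gE 3 1 - gE 4 2, gE 1 4 + gE 2 3 - gE 3 1 - gE 4 2,
    gE 1 1 + gE 2 2 - gE 3 3 - gE 4 4, gE 1 1 - gE 2 2, gE 3 3 - gE 4 4, gE 1 2 - gE 2 1,
    gE 3 4 - gE 4 3, gE 1 2 + gE 2 1, gE 3 4 + gE 4 3]

def κ₈ : Fin 15 → Fin 14 := ![0, 1, 2, 3, 4, 5, 6, 7, 8, 9, 10, 11, 12, 13, 13]

def aut₈ : Fin 3 → AutData :=
  ![unitaryAut (diagonal ![1, -1, gI, -gI]) false,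
    unitaryAut gK₂ true,
    unitaryAut !![0, 1, 0, 0; 1, 0, 0, 0; 0, 0, 1, 0; 0, 0, 0, 1] true]

def p₈ : Fin 3 → Fin 14 → GaussianInt :=
  ![![-gI, -gI, -gI, -gI, gI, gI, gI, gI, 1, 1, 1, -1, -1, -1],
    ![-1, -1, 1, 1, -1, 1, -1, 1, -1, -1, 1, 1, -1, -1],
    ![-1, 1, -1, 1, -1, -1, 1, 1, -1, 1, -1, -1, 1, -1]]

theorem isGradingData₈ : IsGradingData b₈ κ₈ aut₈ p₈ gK₂ {10, 3, 2, 11, 7, 5} := by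
  constructor <;> decide +kernel

theorem isFrame₈ : IsFrame Γ₈ (fun i => toM (b₈ i)) κ₈ := by
  refine isFrame_of_orthogonal isGradingData₈.orthogonal isGradingData₈.surjective 13 {13, 14}
    (by decide) (by decide) (fun i hi => ?_) ?_
  · fin_cases i
    iterate 13 simp [Γ₈, κ₈, b₈, toM_add, toM_sub, toM_gE]
    all_goals exact absurd rfl hi
  · simp [Γ₈, b₈, Set.image_insert_eq, toM_add, toM_gE]

theorem hasWeights₈ : HasWeights b₈ κ₈ 13 ![13, 14] ![0, 1, 9, 10] ![7, 5, 11, 12]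
    ![![1, -1], ![-1, -1], ![-2, 0], ![0, -2]] := by
  constructor <;> decide +kernel

theorem isDisplayFrame₈ : IsDisplayFrame Γ₈ S₈ K₂ (fun i => toM (b₈ i)) κ₈ := by
  have hu : IsUnsplittable Γ₈ 13 := by
    refine hasWeights₈.isUnsplittable isFrame₈ fun α β h => ?_
    simp [Fin.forall_fin_succ, Fin.sum_univ_two] at h
    -- The four forms are pairwise independent, so the pigeonhole argument used for `Γ₄` applies.
    have : (α 0 = 0 ∧ α 1 = 0) ∨ (β 0 = 0 ∧ β 1 = 0) := by grind
    simpa [funext_iff, Fin.forall_fin_succ] using this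
  have h := isGradingData₈.isDisplayFrame isFrame₈
    (isUnsplittable_of_isLineIndex isFrame₈ 13 (by decide) hu)
    (isUnsplittable_restrict_of_isLineIndex isFrame₈ _ (by decide))
  rw [toM_gK₂] at h
  simpa [S₈] using h

/-! ### The isomorphisms with the standard real forms -/

/-- An isomorphism given by a change of basis. -/
theorem nonempty_lieEquiv_of_conj {n : Type} [Fintype n] [DecidableEq n] {L : Type} [LieRing L]
    [LieAlgebra ℝ L] {H : LieSubalgebra ℝ M4} {S : Matrix n (Fin 4) ℂ} {T : Matrix (Fin 4) n ℂ}
    (hST : S * T = 1) (hTS : T * S = 1) (f : L →ₗ⁅ℝ⁆ Matrix n n ℂ) (hf : Function.Injective f)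
    (hfH : ∀ Y, T * f Y * S ∈ H) (hHf : ∀ X ∈ H, ∃ Y, f Y = S * X * T) :
    Nonempty (H ≃ₗ⁅ℝ⁆ L) := by
  have key : ∀ Y Z : Matrix n n ℂ, T * (Y * Z) * S = T * Y * S * (T * Z * S) := fun Y Z => by
    simp only [Matrix.mul_assoc]
    rw [← Matrix.mul_assoc S T, hST, Matrix.one_mul]
  let g : L →ₗ⁅ℝ⁆ H :=
    { toFun := fun Y => ⟨T * f Y * S, hfH Y⟩
      map_add' := fun Y Z => Subtype.ext (by simp [Matrix.mul_add, Matrix.add_mul])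
      map_smul' := fun c Y => Subtype.ext (by simp)
      map_lie' := fun {Y Z} => Subtype.ext (by
        simp only [LieHom.map_lie, Ring.lie_def, LieSubalgebra.coe_bracket, ← key,
          Matrix.mul_sub, Matrix.sub_mul]) }
  refine ⟨(LieEquiv.ofBijective g ⟨fun Y Z h => hf ?_, fun X => ?_⟩).symm⟩
  · have h' : T * f Y * S = T * f Z * S := congrArg Subtype.val h
    have h'' : S * (T * f Y * S) * T = S * (T * f Z * S) * T := by rw [h']
    simpa only [Matrix.mul_assoc, hST, Matrix.mul_one, ← Matrix.mul_assoc S T, Matrix.one_mul]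
      using h''
  · obtain ⟨Y, hY⟩ := hHf X X.2
    refine ⟨Y, Subtype.ext ?_⟩
    change T * f Y * S = X
    rw [hY]
    simp only [Matrix.mul_assoc, hTS, Matrix.mul_one, ← Matrix.mul_assoc T S, Matrix.one_mul]

/-- The inclusion of the real matrices into the complex ones. -/
def ofRealHom (n : Type) [Fintype n] [DecidableEq n] : Matrix n n ℝ →ₗ⁅ℝ⁆ Matrix n n ℂ :=
  AlgHom.toLieHom (Complex.ofRealAm.mapMatrix)

theorem ofRealHom_injective (n : Type) [Fintype n] [DecidableEq n] :
    Function.Injective (ofRealHom n) := fun X Y h => by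
  ext i j
  exact Complex.ofReal_injective (congrFun (congrFun h i) j)

open LieAlgebra.Orthogonal (indefiniteDiagonal)

theorem indefiniteDiagonal_mul_self (p q R : Type) [Fintype p] [Fintype q] [DecidableEq p]
    [DecidableEq q] [CommRing R] : indefiniteDiagonal p q R * indefiniteDiagonal p q R = 1 := by
  rw [indefiniteDiagonal, Matrix.diagonal_mul_diagonal, ← Matrix.diagonal_one]
  congr 1
  ext (i | i) <;> simp

theorem transpose_indefiniteDiagonal (p q R : Type) [DecidableEq p] [DecidableEq q]
    [CommRing R] : (indefiniteDiagonal p q R)ᵀ = indefiniteDiagonal p q R :=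
  Matrix.diagonal_transpose _

theorem indefiniteDiagonal_map {p q R R' : Type} [DecidableEq p] [DecidableEq q] [CommRing R]
    [CommRing R'] (f : R →+* R') :
    (indefiniteDiagonal p q R).map f = indefiniteDiagonal p q R' := by
  rw [indefiniteDiagonal, Matrix.diagonal_map (map_zero f),
    indefiniteDiagonal]
  congr 1
  ext (i | i) <;> simp

theorem mem_soReal_iff {p q : ℕ} {Y : Matrix (Fin p ⊕ Fin q) (Fin p ⊕ Fin q) ℝ} :
    Y ∈ soReal p q ↔
      Y * indefiniteDiagonal (Fin p) (Fin q) ℝ = -(indefiniteDiagonal (Fin p) (Fin q) ℝ * Yᵀ) := by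
  have hD := indefiniteDiagonal_mul_self (Fin p) (Fin q) ℝ
  have h : Y ∈ soReal p q ↔
      Yᵀ * indefiniteDiagonal (Fin p) (Fin q) ℝ = indefiniteDiagonal (Fin p) (Fin q) ℝ * (-Y) :=
    mem_skewAdjointMatricesSubmodule _ _
  rw [h]
  generalize indefiniteDiagonal (Fin p) (Fin q) ℝ = I at hD
  constructor
  · intro h
    rw [← Matrix.mul_one Yᵀ, ← hD, ← Matrix.mul_assoc Yᵀ, h, ← Matrix.mul_assoc, ← Matrix.mul_assoc,
      hD, Matrix.one_mul, neg_mul, neg_neg]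
  · intro h
    have h' : I * Yᵀ = -(Y * I) := by rw [h, neg_neg]
    rw [← Matrix.one_mul Yᵀ, ← hD, Matrix.mul_assoc I, h', Matrix.mul_neg, Matrix.neg_mul,
      Matrix.mul_assoc, Matrix.mul_assoc, hD, Matrix.mul_one, Matrix.mul_neg]

/-- A change of basis takes the relation `Z I = ± I Z'` into `X K = ± K X'`. -/
theorem mul_eq_of_conj {m n : Type} [Fintype m] [Fintype n] {S : Matrix n m ℂ} {T : Matrix m n ℂ}
    {K : Matrix m m ℂ} {I : Matrix n n ℂ} {T' : Matrix m n ℂ} {S' : Matrix n m ℂ} {c r : ℂ}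
    (hS : S * K = c • (I * S')) (hT : K * T' = c • (T * I)) {Z Z' : Matrix n n ℂ}
    (hZ : Z * I = r • (I * Z')) : T * Z * S * K = r • (K * (T' * Z' * S')) := by
  calc T * Z * S * K = c • (T * (Z * I) * S') := by
        rw [Matrix.mul_assoc, hS, Matrix.mul_smul]
        simp only [Matrix.mul_assoc]
    _ = r • (K * T' * Z' * S') := by
        rw [hZ, hT]
        simp only [Matrix.mul_assoc, Matrix.mul_smul, Matrix.smul_mul, smul_smul, mul_comm]
    _ = r • (K * (T' * Z' * S')) := by simp only [Matrix.mul_assoc]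

/-- The matrix `S` takes the symmetric form `K` and the hermitian form `E` to multiples of the same
`I`. In the new basis an element `Z` satisfies `Z I = -I Zᵀ` and `Z I = -I Zᴴ`, so `Zᴴ = Zᵀ`, that
is, `Z` is real. -/
theorem nonempty_lieEquiv_soReal {K E : M4} (hK : K * K = 1) (hKt : Kᵀ = K) (hEh : Eᴴ = E)
    {p q : ℕ} (hpq : p + q = 4) {S : Matrix (Fin p ⊕ Fin q) (Fin 4) ℂ} {c c' : ℂ} (hc : c ≠ 0)
    (hc' : c' ≠ 0) (hcs : star c' = c')
    (hSK : S * K * Sᵀ = c • indefiniteDiagonal (Fin p) (Fin q) ℂ)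
    (hSE : S * E * Sᴴ = c' • indefiniteDiagonal (Fin p) (Fin q) ℂ) :
    Nonempty (oInter K (su E) ≃ₗ⁅ℝ⁆ soReal p q) := by
  set I := indefiniteDiagonal (Fin p) (Fin q) ℂ with hI
  have hII : I * I = 1 := indefiniteDiagonal_mul_self _ _ _
  have hIt : Iᵀ = I := transpose_indefiniteDiagonal _ _ _
  have hIs : I.map (starRingEnd ℂ) = I := indefiniteDiagonal_map _
  have hIh : Iᴴ = I := by
    rw [conjTranspose, hIt]
    exact hIs
  -- The relation `S K Sᵀ = c I` with `I² = 1` provides the inverse of `S`.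
  obtain ⟨T, hT⟩ : ∃ T, T = c⁻¹ • (K * Sᵀ * I) := ⟨_, rfl⟩
  have hST : S * T = 1 := by
    rw [hT, Matrix.mul_smul, ← Matrix.mul_assoc, ← Matrix.mul_assoc, hSK, Matrix.smul_mul, hII,
      smul_smul, inv_mul_cancel₀ hc, one_smul]
  have hTS : T * S = 1 :=
    (Matrix.mul_eq_one_comm_of_card_eq _ _ _ (by simp [hpq])).1 hST
  have hKS : K * Sᵀ = c • (T * I) := by
    rw [hT, Matrix.smul_mul, Matrix.mul_assoc, hII, Matrix.mul_one, smul_smul, mul_inv_cancel₀ hc,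
      one_smul]
  have hES : E * Sᴴ = c' • (T * I) := by
    rw [← Matrix.mul_smul, ← hSE, ← Matrix.mul_assoc, ← Matrix.mul_assoc, hTS, Matrix.one_mul]
  have hSK' : S * K = c • (I * Tᵀ) := by
    have := congrArg transpose hKS
    simpa [hKt, hIt] using this
  have hSE' : S * E = c' • (I * Tᴴ) := by
    have := congrArg conjTranspose hES
    rwa [conjTranspose_mul, conjTranspose_conjTranspose, hEh, conjTranspose_smul, hcs,
      conjTranspose_mul, hIh] at this
  refine nonempty_lieEquiv_of_conj hST hTS ((ofRealHom _).comp (soReal p q).incl)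
    ((ofRealHom_injective _).comp Subtype.val_injective) ?_ ?_
  · rintro ⟨Y, hY⟩
    rw [mem_soReal_iff] at hY
    obtain ⟨Z, hZ⟩ : ∃ Z, Z = ofRealHom _ Y := ⟨_, rfl⟩
    have hZI : Z * I = (-1 : ℂ) • (I * Zᵀ) := by
      have h := congrArg (ofRealHom _) hY
      have hD : ofRealHom _ (indefiniteDiagonal (Fin p) (Fin q) ℝ) = I :=
        indefiniteDiagonal_map Complex.ofRealHom
      have hm : ∀ X X', ofRealHom (Fin p ⊕ Fin q) (X * X') = ofRealHom _ X * ofRealHom _ X' :=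
        fun X X' => map_mul (Complex.ofRealAm.mapMatrix) X X'
      rw [hm, map_neg, hm, hD, ← hZ] at h
      rw [h, neg_one_smul, hZ]
      rfl
    have hZh : Zᴴ = Zᵀ := by
      rw [hZ]
      ext i j
      exact Complex.conj_ofReal _
    change T * ofRealHom _ Y * S ∈ oInter K (su E)
    rw [← hZ]
    have h₁ : T * Z * S * K = -(K * (T * Z * S)ᵀ) := by
      rw [mul_eq_of_conj hSK' hKS hZI, neg_one_smul]
      simp only [transpose_mul, Matrix.mul_assoc]
    refine ⟨h₁, trace_eq_zero_of_mem_oAlg hK h₁, ?_⟩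
    rw [mul_eq_of_conj hSE' hES (hZh ▸ hZI), neg_one_smul]
    simp only [conjTranspose_mul, Matrix.mul_assoc]
  · rintro X ⟨hXK, -, hXE⟩
    have hXK' : X * K = (-1 : ℂ) • (K * Xᵀ) := by rw [neg_one_smul]; exact hXK
    have hXE' : X * E = (-1 : ℂ) • (E * Xᴴ) := by rw [neg_one_smul]; exact hXE
    have h₁ : S * X * T * I = -(I * (S * X * T)ᵀ) := by
      rw [mul_eq_of_conj (c := c⁻¹) (T' := Tᵀ) (S' := Sᵀ) (by rw [hKS, inv_smul_smul₀ hc])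
        (by rw [hSK', inv_smul_smul₀ hc]) hXK', neg_one_smul]
      simp only [transpose_mul, Matrix.mul_assoc]
    have h₂ : S * X * T * I = -(I * (S * X * T)ᴴ) := by
      rw [mul_eq_of_conj (c := c'⁻¹) (T' := Tᴴ) (S' := Sᴴ) (by rw [hES, inv_smul_smul₀ hc'])
        (by rw [hSE', inv_smul_smul₀ hc']) hXE', neg_one_smul]
      simp only [conjTranspose_mul, Matrix.mul_assoc]
    obtain ⟨Z, hZ⟩ : ∃ Z, Z = S * X * T := ⟨_, rfl⟩
    rw [← hZ] at h₁ h₂ ⊢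
    have h₃ : Zᴴ = Zᵀ := by
      rw [h₁, neg_inj] at h₂
      rw [← Matrix.one_mul Zᴴ, ← hII, Matrix.mul_assoc, ← h₂, ← Matrix.mul_assoc, hII,
        Matrix.one_mul]
    have h₄ : ofRealHom _ (Z.map Complex.re) = Z := by
      ext i j
      exact Complex.conj_eq_iff_re.1 (congrFun (congrFun h₃ j) i)
    refine ⟨⟨Z.map Complex.re, mem_soReal_iff.2 (ofRealHom_injective _ ?_)⟩, h₄⟩
    have hD : ofRealHom _ (indefiniteDiagonal (Fin p) (Fin q) ℝ) = I :=
      indefiniteDiagonal_map Complex.ofRealHom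
    have hm : ∀ X X', ofRealHom (Fin p ⊕ Fin q) (X * X') = ofRealHom _ X * ofRealHom _ X' :=
      fun X X' => map_mul (Complex.ofRealAm.mapMatrix) X X'
    have ht : ofRealHom _ (Z.map Complex.re)ᵀ = Zᵀ := congrArg transpose h₄
    rw [hm, map_neg, hm, hD, h₄, ht, h₁]

/-- Here `S` makes `K` a multiple of the identity and intertwines the antilinear maps given by `F`
and `J`, up to the scalar `c'`. -/
theorem nonempty_lieEquiv_soStar {K F : M4} (hK : K * K = 1) (hKt : Kᵀ = K)
    {S : Matrix (Fin 2 ⊕ Fin 2) (Fin 4) ℂ} {c c' : ℂ} (hc : c ≠ 0) (hc' : c' ≠ 0)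
    (hSK : S * K * Sᵀ = c • (1 : Matrix (Fin 2 ⊕ Fin 2) (Fin 2 ⊕ Fin 2) ℂ))
    (hSF : S * F = c' • (Matrix.J (Fin 2) ℂ * S.map (starRingEnd ℂ))) :
    Nonempty (oInter K (suStar F) ≃ₗ⁅ℝ⁆ soStar) := by
  have hJ : (Matrix.J (Fin 2) ℂ).map (starRingEnd ℂ) = Matrix.J (Fin 2) ℂ := by
    ext (i | i) (j | j) <;> simp [Matrix.J, Matrix.one_apply, apply_ite]
  have hst : ∀ {l m n : Type} [Fintype m] (X : Matrix l m ℂ) (Y : Matrix m n ℂ),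
      (X * Y).map (starRingEnd ℂ) = X.map (starRingEnd ℂ) * Y.map (starRingEnd ℂ) :=
    fun X Y => Matrix.map_mul
  have hss : ∀ {l m : Type} (X : Matrix l m ℂ),
      (X.map (starRingEnd ℂ)).map (starRingEnd ℂ) = X := fun X => by
    ext i j
    simp
  obtain ⟨T, hT⟩ : ∃ T, T = c⁻¹ • (K * Sᵀ) := ⟨_, rfl⟩
  have hST : S * T = 1 := by
    rw [hT, Matrix.mul_smul, ← Matrix.mul_assoc, hSK, smul_smul, inv_mul_cancel₀ hc, one_smul]
  have hTS : T * S = 1 :=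
    (Matrix.mul_eq_one_comm_of_card_eq _ _ _ (by simp)).1 hST
  have hKS : K * Sᵀ = c • (T * (1 : Matrix (Fin 2 ⊕ Fin 2) (Fin 2 ⊕ Fin 2) ℂ)) := by
    rw [hT, Matrix.mul_one, smul_smul, mul_inv_cancel₀ hc, one_smul]
  have hSK' : S * K = c • ((1 : Matrix (Fin 2 ⊕ Fin 2) (Fin 2 ⊕ Fin 2) ℂ) * Tᵀ) := by
    have := congrArg transpose hKS
    simpa [hKt] using this
  have hSTs : S.map (starRingEnd ℂ) * T.map (starRingEnd ℂ) = 1 := by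
    rw [← hst, hST, Matrix.map_one _ (map_zero _) (map_one _)]
  have hFT : F * T.map (starRingEnd ℂ) = c' • (T * Matrix.J (Fin 2) ℂ) := by
    rw [← Matrix.one_mul F, ← hTS, Matrix.mul_assoc T, hSF, Matrix.mul_smul, Matrix.smul_mul,
      Matrix.mul_assoc, Matrix.mul_assoc, hSTs, Matrix.mul_one]
  -- For skew `Y` one has `Yᴴ = -Ȳ`, and `J` is real; conjugation then turns the condition of
  -- `so*(4)` into the shape of the one in `suStar`.
  have hconj : ∀ Y : Matrix (Fin 2 ⊕ Fin 2) (Fin 2 ⊕ Fin 2) ℂ, Yᵀ = -Y →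
      (Yᴴ * Matrix.J (Fin 2) ℂ + Matrix.J (Fin 2) ℂ * Y = 0 ↔
        Y * Matrix.J (Fin 2) ℂ = Matrix.J (Fin 2) ℂ * Y.map (starRingEnd ℂ)) := by
    intro Y hY
    have hYh : Yᴴ = -Y.map (starRingEnd ℂ) := by
      rw [conjTranspose, hY]
      ext i j
      simp
    rw [hYh, neg_mul, neg_add_eq_zero]
    constructor
    · intro h
      have := congrArg (fun X => X.map (starRingEnd ℂ)) h
      simpa only [hst, hss, hJ] using this
    · intro h
      have := congrArg (fun X => X.map (starRingEnd ℂ)) h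
      simpa only [hst, hss, hJ] using this
  refine nonempty_lieEquiv_of_conj hST hTS soStar.incl Subtype.val_injective ?_ ?_
  · rintro ⟨Y, hYt, hYJ⟩
    rw [hconj Y hYt] at hYJ
    change T * Y * S ∈ oInter K (suStar F)
    have h₁ : T * Y * S * K = -(K * (T * Y * S)ᵀ) := by
      rw [mul_eq_of_conj (r := -1) (Z' := Yᵀ) hSK' hKS (by simp [hYt]), neg_one_smul]
      simp only [transpose_mul, Matrix.mul_assoc]
    refine ⟨h₁, trace_eq_zero_of_mem_oAlg hK h₁, ?_⟩
    rw [mul_eq_of_conj (r := 1) hSF hFT (by rw [hYJ, one_smul]), one_smul, hst, hst]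
  · rintro X ⟨hXK, -, hXF⟩
    have hXK' : X * K = (-1 : ℂ) • (K * Xᵀ) := by rw [neg_one_smul]; exact hXK
    have hXF' : X * F = (1 : ℂ) • (F * X.map (starRingEnd ℂ)) := by rw [one_smul]; exact hXF
    have h₁ : (S * X * T)ᵀ = -(S * X * T) := by
      have := mul_eq_of_conj (c := c⁻¹) (T' := Tᵀ) (S' := Sᵀ) (by rw [hKS, inv_smul_smul₀ hc])
        (by rw [hSK', inv_smul_smul₀ hc]) hXK'
      rw [Matrix.mul_one, Matrix.one_mul, neg_one_smul] at this
      calc (S * X * T)ᵀ = Tᵀ * Xᵀ * Sᵀ := by simp only [transpose_mul, Matrix.mul_assoc]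
        _ = -(S * X * T) := by rw [this, neg_neg]
    refine ⟨⟨S * X * T, h₁, (hconj _ h₁).2 ?_⟩, rfl⟩
    rw [mul_eq_of_conj (c := c'⁻¹) (T' := S.map (starRingEnd ℂ)) (S' := T.map (starRingEnd ℂ))
      (by rw [hFT, inv_smul_smul₀ hc']) (by rw [hSF, inv_smul_smul₀ hc']) hXF', one_smul, hst, hst]

/-! ### Signatures -/

/-- The eigenvalues are `±1`, so their number and their sum, the trace, determine both
multiplicities. -/
theorem hasSignature_of_sq {E : M4} (hE : E.IsHermitian) (hE2 : E * E = 1) {p q : ℕ}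
    (hpq : p + q = 4) (htr : E.trace = p - q) : HasSignature E p q := by
  refine ⟨hpq, hE, ?_⟩
  have hev : ∀ i, hE.eigenvalues i = 1 ∨ hE.eigenvalues i = -1 := by
    intro i
    have h₁ := hE.mulVec_eigenvectorBasis i
    have h₂ : (hE.eigenvalues i * hE.eigenvalues i) • ⇑(hE.eigenvectorBasis i) =
        (1 : ℝ) • ⇑(hE.eigenvectorBasis i) := by
      rw [← smul_smul, ← h₁, ← Matrix.mulVec_smul, ← h₁, Matrix.mulVec_mulVec, hE2,
        Matrix.one_mulVec, one_smul]
    have h₃ : (⇑(hE.eigenvectorBasis i) : Fin 4 → ℂ) ≠ 0 := fun h =>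
      hE.eigenvectorBasis.orthonormal.ne_zero i (by ext j; exact congrFun h j)
    exact mul_self_eq_one_iff.1 (smul_left_injective ℝ h₃ h₂)
  have hsum : ∑ i, hE.eigenvalues i = (p : ℝ) - q := by
    have := hE.trace_eq_sum_eigenvalues
    rw [htr] at this
    apply Complex.ofReal_injective
    push_cast
    exact this.symm
  have hpos : ∀ i, 0 < hE.eigenvalues i ↔ hE.eigenvalues i = 1 := fun i => by
    rcases hev i with h | h <;> rw [h] <;> norm_num
  have hneg : ∀ i, hE.eigenvalues i < 0 ↔ ¬ hE.eigenvalues i = 1 := fun i => by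
    rcases hev i with h | h <;> rw [h] <;> norm_num
  have hval : ∀ i, hE.eigenvalues i = if hE.eigenvalues i = 1 then 1 else -1 := fun i => by
    rcases hev i with h | h <;> rw [h] <;> norm_num
  simp only [hpos, hneg, Nat.card_eq_fintype_card, Fintype.card_subtype]
  have hcard := Finset.card_filter_add_card_filter_not (s := (Finset.univ : Finset (Fin 4)))
    (fun i => hE.eigenvalues i = 1)
  rw [Finset.sum_congr rfl fun i _ => hval i, Finset.sum_ite, Finset.sum_const, Finset.sum_const,
    nsmul_eq_mul, nsmul_eq_mul, mul_one, mul_neg_one, ← sub_eq_add_neg, sub_eq_sub_iff_add_eq_add]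
    at hsum
  rw [Finset.card_univ, Fintype.card_fin] at hcard
  norm_cast at hsum
  omega

/-! ### The real forms of `sl(4, ℂ)` -/

theorem eq_zero_of_I_smul_eq_neg {X : M4} (h : Complex.I • X = -(Complex.I • X)) : X = 0 := by
  ext i j
  have := self_eq_neg.1 (congrFun (congrFun h i) j)
  simpa using this

/-- The defining condition is antilinear on one side only, so `X` and `i X` both satisfying it gives
`X F = 0`, and `F` is invertible. -/
theorem isTotallyReal_suStar {F : M4} (hF : IsAnticircular F) : IsTotallyReal (suStar F) := by
  rintro X ⟨-, hX⟩ ⟨-, hIX⟩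
  have h : (Complex.I • X).map (starRingEnd ℂ) = -(Complex.I • X.map (starRingEnd ℂ)) := by
    ext i j
    simp
  rw [h, Matrix.mul_neg, Matrix.mul_smul, ← hX, Matrix.smul_mul] at hIX
  have := congrArg (· * F.map (starRingEnd ℂ)) (eq_zero_of_I_smul_eq_neg hIX)
  simpa [Matrix.mul_assoc, show F * F.map (starRingEnd ℂ) = -1 from hF] using this

theorem isTotallyReal_su {E : M4} (hE : E * E = 1) : IsTotallyReal (su E) := by
  rintro X ⟨-, hX⟩ ⟨-, hIX⟩
  have h : (Complex.I • X)ᴴ = -(Complex.I • Xᴴ) := by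
    ext i j
    simp
  have hX' : E * Xᴴ = -(X * E) := by rw [hX, neg_neg]
  rw [h, Matrix.mul_neg, neg_neg, Matrix.mul_smul, hX', Matrix.smul_mul, smul_neg] at hIX
  have := congrArg (· * E) (eq_zero_of_I_smul_eq_neg hIX)
  simpa [Matrix.mul_assoc, hE] using this

/-- The factors by which the basis elements are multiplied to lie in the real forms. -/
def phase : Fin 4 → GaussianInt := ![1, gI, 1 + gI, 1 - gI]

theorem phase_ne_zero (j : Fin 4) : (phase j : ℂ) ≠ 0 := by
  rw [Ne, GaussianInt.toComplex_eq_zero]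
  revert j
  decide +kernel

theorem isAnticircular_toM {F : GMat} (hF : F * F.map star = -1) : IsAnticircular (toM F) := by
  rw [IsAnticircular, ← toM_star, ← toM_mul, hF, toM_neg, toM_one]

theorem toM_indefiniteDiagonal (p q : ℕ) :
    toM (indefiniteDiagonal (Fin p) (Fin q) GaussianInt) = indefiniteDiagonal (Fin p) (Fin q) ℂ :=
  indefiniteDiagonal_map _

theorem toM_J : toM (Matrix.J (Fin 2) GaussianInt) = Matrix.J (Fin 2) ℂ := by
  ext (i | i) (j | j) <;> simp [toM, Matrix.J, Matrix.one_apply, apply_ite]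

/-- If the antilinear involution fixing `P` sends `b` to `ζ b`, then `c b ∈ P` means `c / c̄ = ζ`.
The values of `phase` realize `ζ = 1, -1, i, -i`, which suffices in all 14 cases. -/
theorem IsDisplayFrame.displays_of_phase {n : ℕ} {Γ : Fin n → Submodule ℂ M4} {S : Set (Fin n)}
    {K : M4} {b : Fin 15 → GMat} {κ : Fin 15 → Fin n}
    (h : IsDisplayFrame Γ S K (fun i => toM (b i)) κ) {P : LieSubalgebra ℝ M4}
    (hP : IsTotallyReal P) (htr : ∀ x ∈ P, x.trace = 0)
    (hb : ∀ i, ∃ j, (toM (phase j • b i)).trace = 0 → toM (phase j • b i) ∈ P) {R : Type}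
    [LieRing R] [LieAlgebra ℝ R] (hR : Nonempty (oInter K P ≃ₗ⁅ℝ⁆ R)) : Displays Γ S K P R := by
  choose j hj using hb
  refine h.displays hP htr (fun i => phase_ne_zero (j i)) (fun i => ?_) hR
  rw [← toM_smul]
  refine hj i ?_
  have hi : toM (b i) ∈ sl4.toSubmodule := h.span_range ▸ Submodule.subset_span ⟨i, rfl⟩
  have hi' : (toM (b i)).trace = 0 := hi
  rw [toM_smul, trace_smul, hi', smul_zero]

theorem IsDisplayFrame.displays_suStar {n : ℕ} {Γ : Fin n → Submodule ℂ M4} {S : Set (Fin n)}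
    {K : M4} {b : Fin 15 → GMat} {κ : Fin 15 → Fin n}
    (h : IsDisplayFrame Γ S K (fun i => toM (b i)) κ) {F : GMat} (hF : IsAnticircular (toM F))
    (hR : Nonempty (oInter K (suStar (toM F)) ≃ₗ⁅ℝ⁆ soStar))
    (hb : ∀ i, ∃ j, phase j • b i * F = F * (phase j • b i).map star) :
    Displays Γ S K (suStar (toM F)) soStar := by
  refine h.displays_of_phase (isTotallyReal_suStar hF) (fun x hx => hx.1) (fun i => ?_) hR
  obtain ⟨j, hj⟩ := hb i
  exact ⟨j, fun ht => ⟨ht, by rw [← toM_mul, hj, toM_mul, toM_star]⟩⟩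

theorem IsDisplayFrame.displays_su {n : ℕ} {Γ : Fin n → Submodule ℂ M4} {S : Set (Fin n)}
    {K : M4} {b : Fin 15 → GMat} {κ : Fin 15 → Fin n}
    (h : IsDisplayFrame Γ S K (fun i => toM (b i)) κ) {E : GMat} (hE : toM E * toM E = 1)
    {R : Type} [LieRing R] [LieAlgebra ℝ R]
    (hR : Nonempty (oInter K (su (toM E)) ≃ₗ⁅ℝ⁆ R))
    (hb : ∀ i, ∃ j, phase j • b i * E = -(E * (phase j • b i)ᴴ)) :
    Displays Γ S K (su (toM E)) R := by
  refine h.displays_of_phase (isTotallyReal_su hE) (fun x hx => hx.1) (fun i => ?_) hR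
  obtain ⟨j, hj⟩ := hb i
  exact ⟨j, fun ht => ⟨ht, by rw [← toM_mul, hj, toM_neg, toM_mul, toM_conjTranspose]⟩⟩

theorem nonempty_lieEquiv_soStar_toM {K F : GMat} (S : Matrix (Fin 2 ⊕ Fin 2) (Fin 4) GaussianInt)
    (c c' : GaussianInt) (hK : K * K = 1 ∧ Kᵀ = K) (hc : c ≠ 0 ∧ c' ≠ 0)
    (hSK : S * K * Sᵀ = c • (1 : Matrix (Fin 2 ⊕ Fin 2) (Fin 2 ⊕ Fin 2) GaussianInt))
    (hSF : S * F = c' • (Matrix.J (Fin 2) GaussianInt * S.map star)) :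
    Nonempty (oInter (toM K) (suStar (toM F)) ≃ₗ⁅ℝ⁆ soStar) := by
  refine nonempty_lieEquiv_soStar (S := toM S) (c := c) (c' := c') ?_ ?_ ?_ ?_ ?_ ?_
  · rw [← toM_mul, hK.1, toM_one]
  · rw [← toM_transpose, hK.2]
  · exact mt GaussianInt.toComplex_eq_zero.1 hc.1
  · exact mt GaussianInt.toComplex_eq_zero.1 hc.2
  · rw [← toM_transpose, ← toM_mul, ← toM_mul, hSK, toM_smul, toM_one]
  · rw [← toM_star, ← toM_J, ← toM_mul, ← toM_mul, hSF, toM_smul]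

theorem nonempty_lieEquiv_soReal_toM {K E : GMat} {p q : ℕ}
    (S : Matrix (Fin p ⊕ Fin q) (Fin 4) GaussianInt) (c : GaussianInt) (hpq : p + q = 4)
    (hK : K * K = 1 ∧ Kᵀ = K) (hE : Eᴴ = E) (hc : c ≠ 0 ∧ star c = c)
    (hSK : S * K * Sᵀ = c • indefiniteDiagonal (Fin p) (Fin q) GaussianInt)
    (hSE : S * E * Sᴴ = c • indefiniteDiagonal (Fin p) (Fin q) GaussianInt) :
    Nonempty (oInter (toM K) (su (toM E)) ≃ₗ⁅ℝ⁆ soReal p q) := by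
  have hc' : (c : ℂ) ≠ 0 := mt GaussianInt.toComplex_eq_zero.1 hc.1
  refine nonempty_lieEquiv_soReal (S := toM S) ?_ ?_ ?_ hpq hc' hc' ?_ ?_ ?_
  · rw [← toM_mul, hK.1, toM_one]
  · rw [← toM_transpose, hK.2]
  · rw [← toM_conjTranspose, hE]
  · conv_rhs => rw [← hc.2]
    exact (GaussianInt.toComplex_star c).symm
  · rw [← toM_transpose, ← toM_mul, ← toM_mul, hSK, toM_smul, toM_indefiniteDiagonal]
  · rw [← toM_conjTranspose, ← toM_mul, ← toM_mul, hSE, toM_smul, toM_indefiniteDiagonal]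

/-! ### The defining matrices of the real forms -/

def gF₁ : GMat := !![0, 0, 1, 0; 0, 0, 0, 1; -1, 0, 0, 0; 0, -1, 0, 0]

def gF₂ : GMat := !![0, 1, 0, 0; -1, 0, 0, 0; 0, 0, 0, gI; 0, 0, -gI, 0]

def gE31 : GMat := diagonal ![1, 1, 1, -1]

def gE22₁ : GMat := diagonal ![1, 1, -1, -1]

def gE22₂ : GMat := !![1, 0, 0, 0; 0, -1, 0, 0; 0, 0, 0, 1; 0, 0, 1, 0]

def gE22₅ : GMat := !![1, 0, 0, 0; 0, -1, 0, 0; 0, 0, 0, gI; 0, 0, -gI, 0]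

theorem toM_gF₁ : toM gF₁ = F₁ := by
  ext i j
  fin_cases i <;> fin_cases j <;> simp [toM, gF₁, F₁]

theorem toM_gF₂ : toM gF₂ = F₂ := by
  ext i j
  fin_cases i <;> fin_cases j <;> simp [toM, gF₂, F₂, gI, GaussianInt.toComplex_def]

theorem toM_gE31 : toM gE31 = E31₁ := by
  ext i j
  fin_cases i <;> fin_cases j <;> simp [toM, gE31, E31₁]

theorem toM_gE22₁ : toM gE22₁ = E22₁ := by
  ext i j
  fin_cases i <;> fin_cases j <;> simp [toM, gE22₁, E22₁]

theorem toM_gE22₂ : toM gE22₂ = E22₂ := by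
  ext i j
  fin_cases i <;> fin_cases j <;> simp [toM, gE22₂, E22₂]

theorem toM_gE22₅ : toM gE22₅ = E22₅ := by
  ext i j
  fin_cases i <;> fin_cases j <;> simp [toM, gE22₅, E22₅, gI, GaussianInt.toComplex_def]

theorem hasSignature_toM (E : GMat) {p q : ℕ} (hE : Eᴴ = E) (hE2 : E * E = 1) (hpq : p + q = 4)
    (htr : E.trace = p - q) : HasSignature (toM E) p q := by
  refine hasSignature_of_sq ?_ ?_ hpq ?_
  · rw [IsHermitian, ← toM_conjTranspose, hE]
  · rw [← toM_mul, hE2, toM_one]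
  · rw [toM_trace, htr]
    simp

/-- The hermitian matrices are involutions. -/
theorem toM_mul_self {E : GMat} (h : E * E = 1) : toM E * toM E = 1 := by
  rw [← toM_mul, h, toM_one]

end FineGradings

end

/-! ### The fourteen cases -/

open FineGradings in
theorem mainTheorem6 :
    -- the source real forms of `sl(4, ℂ)`: `su*(4)`, `su(4,0)`, `su(3,1)`, `su(2,2)`
    (IsAnticircular F₁ ∧ IsAnticircular F₂ ∧
      HasSignature E40₁ 4 0 ∧
      HasSignature E31₁ 3 1 ∧ HasSignature E31₂ 3 1 ∧
      HasSignature E22₁ 2 2 ∧ HasSignature E22₂ 2 2 ∧ HasSignature E22₃ 2 2 ∧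
      HasSignature E22₅ 2 2) ∧
    -- `so*(4)`
    (Displays Γ₆ S₆ K₃ (suStar F₁) soStar ∧
      Displays Γ₇ S₇ K₁ (suStar F₁) soStar ∧
      Displays Γ₈ S₈ K₂ (suStar F₂) soStar) ∧
    -- `so(4,0)`
    (Displays Γ₃ S₃ K₁ (su E40₁) (soReal 4 0) ∧
      Displays Γ₇ S₇ K₁ (su E40₁) (soReal 4 0)) ∧
    -- `so(3,1)`
    (Displays Γ₃ S₃ K₁ (su E31₁) (soReal 3 1) ∧
      Displays Γ₄ S₄ K₂ (su E31₂) (soReal 3 1) ∧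
      Displays Γ₈ S₈ K₂ (su E31₂) (soReal 3 1)) ∧
    -- `so(2,2)`
    (Displays Γ₃ S₃ K₁ (su E22₁) (soReal 2 2) ∧
      Displays Γ₄ S₄ K₂ (su E22₂) (soReal 2 2) ∧
      Displays Γ₅ S₅ K₃ (su E22₃) (soReal 2 2) ∧
      Displays Γ₆ S₆ K₃ (su E22₃) (soReal 2 2) ∧
      Displays Γ₇ S₇ K₁ (su E22₁) (soReal 2 2) ∧
      Displays Γ₈ S₈ K₂ (su E22₅) (soReal 2 2)) := by
  have hK₁ : K₁ = toM 1 := toM_one.symm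
  have hE40 : E40₁ = toM 1 := toM_one.symm
  have hE31 : E31₂ = toM gK₂ := toM_gK₂.symm
  have hE22 : E22₃ = toM gK₃ := toM_gK₃.symm
  have f₃ := isDisplayFrame₃
  have f₄ := isDisplayFrame₄
  have f₅ := isDisplayFrame₅
  have f₆ := isDisplayFrame₆
  have f₇ := isDisplayFrame₇
  have f₈ := isDisplayFrame₈
  rw [hK₁] at f₃ f₇
  rw [← toM_gK₂] at f₄ f₈
  rw [← toM_gK₃] at f₅ f₆
  simp only [hE40, hE31, hE22, hK₁, ← toM_gF₁, ← toM_gF₂, ← toM_gE31, ← toM_gE22₁, ← toM_gE22₂,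
    ← toM_gE22₅, ← toM_gK₂, ← toM_gK₃]
  have a₁ : IsAnticircular (toM gF₁) := isAnticircular_toM (by decide +kernel)
  have a₂ : IsAnticircular (toM gF₂) := isAnticircular_toM (by decide +kernel)
  have e40 : toM (1 : GMat) * toM 1 = 1 := toM_mul_self (by decide +kernel)
  have e31 : toM gE31 * toM gE31 = 1 := toM_mul_self (by decide +kernel)
  have e31' : toM gK₂ * toM gK₂ = 1 := toM_mul_self (by decide +kernel)
  have e22₁ : toM gE22₁ * toM gE22₁ = 1 := toM_mul_self (by decide +kernel)
  have e22₂ : toM gE22₂ * toM gE22₂ = 1 := toM_mul_self (by decide +kernel)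
  have e22₃ : toM gK₃ * toM gK₃ = 1 := toM_mul_self (by decide +kernel)
  have e22₅ : toM gE22₅ * toM gE22₅ = 1 := toM_mul_self (by decide +kernel)
  have r₁ : Nonempty (oInter (toM 1) (su (toM 1)) ≃ₗ⁅ℝ⁆ soReal 4 0) :=
    nonempty_lieEquiv_soReal_toM (fromRows 1 (of ![])) 1 rfl (by decide +kernel)
      (by decide +kernel) (by decide +kernel) (by decide +kernel) (by decide +kernel)
  -- The factor `i` in the last row changes the sign of the symmetric form there but not that of the
  -- hermitian form, whose sign is already negative.
  have r₂ : Nonempty (oInter (toM 1) (su (toM gE31)) ≃ₗ⁅ℝ⁆ soReal 3 1) :=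
    nonempty_lieEquiv_soReal_toM
      (fromRows !![1, 0, 0, 0; 0, 1, 0, 0; 0, 0, 1, 0] !![0, 0, 0, gI]) 1 rfl (by decide +kernel)
      (by decide +kernel) (by decide +kernel) (by decide +kernel) (by decide +kernel)
  have r₃ : Nonempty (oInter (toM gK₂) (su (toM gK₂)) ≃ₗ⁅ℝ⁆ soReal 3 1) :=
    nonempty_lieEquiv_soReal_toM
      (fromRows !![1, 1, 0, 0; 1, -1, 0, 0; 0, 0, 1, 1] !![0, 0, 1, -1]) 2 rfl (by decide +kernel)
      (by decide +kernel) (by decide +kernel) (by decide +kernel) (by decide +kernel)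
  have r₄ : Nonempty (oInter (toM 1) (su (toM gE22₁)) ≃ₗ⁅ℝ⁆ soReal 2 2) :=
    nonempty_lieEquiv_soReal_toM
      (fromRows !![1, 0, 0, 0; 0, 1, 0, 0] !![0, 0, gI, 0; 0, 0, 0, gI]) 1 rfl (by decide +kernel)
      (by decide +kernel) (by decide +kernel) (by decide +kernel) (by decide +kernel)
  -- The vectors `(2, ±1)` have values `±4` for `σ`, which avoids the square root needed for an
  -- orthonormal basis.
  have r₅ : Nonempty (oInter (toM gK₂) (su (toM gE22₂)) ≃ₗ⁅ℝ⁆ soReal 2 2) :=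
    nonempty_lieEquiv_soReal_toM
      (fromRows !![2, 0, 0, 0; 0, 0, 2, 1] !![0, 2 * gI, 0, 0; 0, 0, 2, -1]) 4 rfl
      (by decide +kernel) (by decide +kernel) (by decide +kernel) (by decide +kernel)
      (by decide +kernel)
  have r₆ : Nonempty (oInter (toM gK₃) (su (toM gK₃)) ≃ₗ⁅ℝ⁆ soReal 2 2) :=
    nonempty_lieEquiv_soReal_toM
      (fromRows !![1, 1, 0, 0; 0, 0, 1, 1] !![1, -1, 0, 0; 0, 0, 1, -1]) 2 rfl (by decide +kernel)
      (by decide +kernel) (by decide +kernel) (by decide +kernel) (by decide +kernel)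
  -- The vectors `(1 - i, ±(1 + i))` diagonalize the symmetric form `σ` and the hermitian form `iε`
  -- at once, with values `±4`.
  have r₇ : Nonempty (oInter (toM gK₂) (su (toM gE22₅)) ≃ₗ⁅ℝ⁆ soReal 2 2) :=
    nonempty_lieEquiv_soReal_toM
      (fromRows !![2, 0, 0, 0; 0, 0, 1 - gI, 1 + gI]
        !![0, 2 * gI, 0, 0; 0, 0, 1 - gI, -1 - gI]) 4 rfl
      (by decide +kernel) (by decide +kernel) (by decide +kernel) (by decide +kernel)
      (by decide +kernel)
  have s₁ : Nonempty (oInter (toM gK₃) (suStar (toM gF₁)) ≃ₗ⁅ℝ⁆ soStar) :=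
    nonempty_lieEquiv_soStar_toM
      (fromRows !![1, 1, 0, 0; 0, 0, gI, -gI] !![0, 0, 1, 1; gI, -gI, 0, 0]) 2 (-1)
      (by decide +kernel) (by decide +kernel) (by decide +kernel) (by decide +kernel)
  -- `Matrix.J` has the blocks `0, -1; 1, 0`, so it is the negative of `F₁`; hence the scalar `-1`.
  have s₂ : Nonempty (oInter (toM 1) (suStar (toM gF₁)) ≃ₗ⁅ℝ⁆ soStar) :=
    nonempty_lieEquiv_soStar_toM
      (fromRows !![1, 0, 0, 0; 0, 1, 0, 0] !![0, 0, 1, 0; 0, 0, 0, 1]) 1 (-1)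
      (by decide +kernel) (by decide +kernel) (by decide +kernel) (by decide +kernel)
  have s₃ : Nonempty (oInter (toM gK₂) (suStar (toM gF₂)) ≃ₗ⁅ℝ⁆ soStar) :=
    nonempty_lieEquiv_soStar_toM
      (fromRows !![1, 1, 0, 0; 0, 0, 1, 1] !![1, -1, 0, 0; 0, 0, -gI, gI]) 2 1
      (by decide +kernel) (by decide +kernel) (by decide +kernel) (by decide +kernel)
  refine ⟨⟨a₁, a₂, ?_, ?_, ?_, ?_, ?_, ?_, ?_⟩,
    ⟨f₆.displays_suStar a₁ s₁ ?_, f₇.displays_suStar a₁ s₂ ?_, f₈.displays_suStar a₂ s₃ ?_⟩,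
    ⟨f₃.displays_su e40 r₁ ?_, f₇.displays_su e40 r₁ ?_⟩,
    ⟨f₃.displays_su e31 r₂ ?_, f₄.displays_su e31' r₃ ?_, f₈.displays_su e31' r₃ ?_⟩,
    ⟨f₃.displays_su e22₁ r₄ ?_, f₄.displays_su e22₂ r₅ ?_, f₅.displays_su e22₃ r₆ ?_,
      f₆.displays_su e22₃ r₆ ?_, f₇.displays_su e22₁ r₄ ?_, f₈.displays_su e22₅ r₇ ?_⟩⟩
  all_goals first
    | exact hasSignature_toM _ (by decide +kernel) (by decide +kernel) rfl (by decide +kernel)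
    | decide +kernel
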